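/- A basic ellitope of size $K$ in $\mathbf{R}^p$ is a set $\mathcal{W}=\{w\in\mathbf{R}^p:\exists t\in\mathcal{T}:\ w^TT_kw\le t_k,\ k\le K\}$, where $T_k\succeq0$ for all $k$, $\sum_kT_k\succ0$, and $\mathcal{T}\subset\mathbf{R}^K_+$ is convex, compact, has nonempty interior, and is monotone (if $0\le t\le t'$ and $t'\in\mathcal{T}$, then $t\in\mathcal{T}$). An ellitope of size $K$ is a linear image of a basic ellitope of size $K$. For such $\mathcal{T}$ put $\phi_{\mathcal{T}}(\mu)=\max_{t\in\mathcal{T}}\mu^Tt$. Let $\mathcal{X}=P\mathcal{W}\subset\mathbf{R}^n$ and $\mathcal{B}_*=Q\mathcal{Z}\subset\mathbf{R}^m$ be ellitopes with nonempty interiors, where $\mathcal{W}\subset\mathbf{R}^p$ is a basic ellitope of size $K$ given by $\mathcal{T}$ and $T_1,\dots,T_K$, and $\mathcal{Z}\subset\mathbf{R}^q$ is a basic ellitope of size $L$ given by $\mathcal{S}$ and $S_1,\dots,S_L$. Let $\mathcal{B}=\{v\in\mathbf{R}^m: v^Ty\le1\ \forall y\in\mathcal{B}_*\}$ be the polar of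 $\mathcal{B}_*$. Writing $\|\cdot\|_{\mathcal{U}}$ for the norm with unit ball $\mathcal{U}$, set $\|A\|_{\mathcal{B},\mathcal{X}}=\max\{\|Ax\|_{\mathcal{B}}:\|x\|_{\mathcal{X}}\le1\}$ for $A\in\mathbf{R}^{m\times n}$. Let $A_1,\dots,A_S\in\mathbf{R}^{m\times n}$, let $\mathcal{A}=\{\sum_s\epsilon_sA_s:\|\epsilon\|_\infty\le1\}$, and let $\|\mathcal{A}\|_{\mathcal{B},\mathcal{X}}=\max_{A\in\mathcal{A}}\|A\|_{\mathcal{B},\mathcal{X}}$ be its robust norm. Let $$ \mathrm{Opt}=\min_{\lambda\ge0,\ \mu\ge0,\ G_s,\ H_s}\left\{\phi_{\mathcal{S}}(\lambda)+\phi_{\mathcal{T}}(\mu):\ \begin{bmatrix}G_s&\frac12Q^TA_sP\\ \frac12P^TA_s^TQ&H_s\end{bmatrix}\succeq0\ (s\le S),\ \ \sum_sG_s\preceq\sum_\ell\lambda_\ell S_\ell,\ \ \sum_sH_s\preceq\sum_k\mu_kT_k\right\}, $$ where $\lambda\in\mathbf{R}^L$, $\mu\in\mathbf{R}^K$, and $G_s$,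 $H_s$ are symmetric $q\times q$ and $p\times p$ matrices. Let $\varkappa(1)=1$, $\varkappa(J)=\frac52\sqrt{\ln(2J)}$ for $J>1$, and, for positive integers $k$, $$ \vartheta(k)=\left[\min_{\alpha\in\mathbf{R}^k,\ \|\alpha\|_1=1}(2\pi)^{-k/2}\int_{\mathbf{R}^k}|\alpha_1u_1^2+\dots+\alpha_ku_k^2|\,e^{-u^Tu/2}\,du\right]^{-1}. $$ Let $\kappa\ge1$ be an integer such that $\mathrm{Rank}(A_s)\le\kappa$ for all $s$. Then the minimum in the definition of $\mathrm{Opt}$ and the maxima in the definitions of $\|\cdot\|_{\mathcal{B},\mathcal{X}}$ and of $\|\mathcal{A}\|_{\mathcal{B},\mathcal{X}}$ are attained, and $$ \|\mathcal{A}\|_{\mathcal{B},\mathcal{X}}\le\mathrm{Opt}\le\varkappa(K)\,\varkappa(L)\,\vartheta(2\kappa)\,\|\mathcal{A}\|_{\mathcal{B},\mathcal{X}}. $$ -/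

import Mathlib

open scoped Matrix
open MeasureTheory

noncomputable section

namespace RobustNorm

/-- The data of a basic ellitope of size `K` in `ℝ^p`: positive semidefinite matrices
`T_1, ..., T_K` with positive definite sum and a convex compact monotone set `𝒯` of nonnegative
vectors of `ℝ^K` with nonempty interior. -/
structure BasicEllitope (p K : ℕ) where
  /-- the matrices `T_k` -/
  form : Fin K → Matrix (Fin p) (Fin p) ℝ
  form_posSemidef : ∀ k, (form k).PosSemidef
  sum_form_posDef : (∑ k, form k).PosDef
  /-- the set `𝒯` -/
  bounds : Set (Fin K → ℝ)
  bounds_nonneg : ∀ t ∈ bounds, 0 ≤ t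
  bounds_convex : Convex ℝ bounds
  bounds_compact : IsCompact bounds
  bounds_monotone : ∀ t t' : Fin K → ℝ, 0 ≤ t → t ≤ t' → t' ∈ bounds → t ∈ bounds
  bounds_interior : (interior bounds).Nonempty

/-- The basic ellitope `{w : ∃ t ∈ 𝒯, wᵀ T_k w ≤ t_k for all k}`. -/
def BasicEllitope.carrier {p K : ℕ} (W : BasicEllitope p K) : Set (Fin p → ℝ) :=
  {w | ∃ t ∈ W.bounds, ∀ k, w ⬝ᵥ (W.form k *ᵥ w) ≤ t k}

/-- The ellitope `P 𝒲`, the image of a basic ellitope `𝒲` under a matrix `P`. -/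
def ellitope {n p K : ℕ} (P : Matrix (Fin n) (Fin p) ℝ) (W : BasicEllitope p K) :
    Set (Fin n → ℝ) :=
  (fun w => P *ᵥ w) '' W.carrier

/-- The polar `{v : vᵀ y ≤ 1 for all y ∈ C}`. -/
def polarSet {m : ℕ} (C : Set (Fin m → ℝ)) : Set (Fin m → ℝ) :=
  {v | ∀ y ∈ C, v ⬝ᵥ y ≤ 1}

/-- The support function `φ_𝒯(μ) = max {μᵀ t : t ∈ 𝒯}`. -/
def supportFn {K : ℕ} (T : Set (Fin K → ℝ)) (mu : Fin K → ℝ) : ℝ :=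
  sSup ((fun t => mu ⬝ᵥ t) '' T)

/-- The values `‖A x‖_ℬ` for `‖x‖_𝒳 ≤ 1`. The norm with unit ball `𝒰` is the Minkowski
functional (gauge) of `𝒰`. -/
def inducedNormValues {m n : ℕ} (B : Set (Fin m → ℝ)) (X : Set (Fin n → ℝ))
    (A : Matrix (Fin m) (Fin n) ℝ) : Set ℝ :=
  {r | ∃ x : Fin n → ℝ, gauge X x ≤ 1 ∧ r = gauge B (A *ᵥ x)}

/-- The induced norm `‖A‖_{ℬ,𝒳} = max {‖A x‖_ℬ : ‖x‖_𝒳 ≤ 1}`. -/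
def inducedNorm {m n : ℕ} (B : Set (Fin m → ℝ)) (X : Set (Fin n → ℝ))
    (A : Matrix (Fin m) (Fin n) ℝ) : ℝ :=
  sSup (inducedNormValues B X A)

/-- The uncertain matrix with box uncertainty `{∑ ε_s A_s : ‖ε‖_∞ ≤ 1}`. The norm on
`Fin S → ℝ` is the sup norm. -/
def boxUncertain {S m n : ℕ} (A : Fin S → Matrix (Fin m) (Fin n) ℝ) :
    Set (Matrix (Fin m) (Fin n) ℝ) :=
  {M | ∃ ε : Fin S → ℝ, ‖ε‖ ≤ 1 ∧ M = ∑ s, ε s • A s}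

/-- The robust norm `max {‖M‖_{ℬ,𝒳} : M ∈ 𝒜}` of a set `𝒜` of matrices. -/
def robustNorm {m n : ℕ} (B : Set (Fin m → ℝ)) (X : Set (Fin n → ℝ))
    (U : Set (Matrix (Fin m) (Fin n) ℝ)) : ℝ :=
  sSup (inducedNorm B X '' U)

/-- The values of the objective `φ_𝒮(λ) + φ_𝒯(μ)` of the semidefinite program at its feasible
solutions `(λ, μ, (G_s), (H_s))`. -/
def optValues {S m n p q K L : ℕ} (W : BasicEllitope p K) (Z : BasicEllitope q L)
    (P : Matrix (Fin n) (Fin p) ℝ) (Q : Matrix (Fin m) (Fin q) ℝ)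
    (A : Fin S → Matrix (Fin m) (Fin n) ℝ) : Set ℝ :=
  {r | ∃ (lam : Fin L → ℝ) (mu : Fin K → ℝ)
      (G : Fin S → Matrix (Fin q) (Fin q) ℝ) (H : Fin S → Matrix (Fin p) (Fin p) ℝ),
      0 ≤ lam ∧ 0 ≤ mu ∧
      (∀ s, (Matrix.fromBlocks (G s) ((1 / 2 : ℝ) • (Qᵀ * A s * P))
        ((1 / 2 : ℝ) • (Pᵀ * (A s)ᵀ * Q)) (H s)).PosSemidef) ∧
      ((∑ l, lam l • Z.form l) - ∑ s, G s).PosSemidef ∧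
      ((∑ k, mu k • W.form k) - ∑ s, H s).PosSemidef ∧
      r = supportFn Z.bounds lam + supportFn W.bounds mu}

/-- The optimal value `Opt` of the semidefinite program. -/
def opt {S m n p q K L : ℕ} (W : BasicEllitope p K) (Z : BasicEllitope q L)
    (P : Matrix (Fin n) (Fin p) ℝ) (Q : Matrix (Fin m) (Fin q) ℝ)
    (A : Fin S → Matrix (Fin m) (Fin n) ℝ) : ℝ :=
  sInf (optValues W Z P Q A)

/-- `ϰ(1) = 1` and `ϰ(J) = (5/2) √(ln (2J))` for `J > 1`. -/
def varkappa (J : ℕ) : ℝ :=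
  if J = 1 then 1 else 5 / 2 * Real.sqrt (Real.log (2 * (J : ℝ)))

/-- The matrix-cube function
`ϑ(k) = [min {(2π)^{-k/2} ∫ |∑ α_i u_i²| exp(-uᵀu/2) du : ‖α‖_1 = 1}]⁻¹` of a positive
integer `k`. -/
def vartheta (k : ℕ) : ℝ :=
  (sInf {r : ℝ | ∃ α : Fin k → ℝ, ∑ i, |α i| = 1 ∧
    r = (2 * Real.pi) ^ (-(k : ℝ) / 2) *
      ∫ u : Fin k → ℝ, |∑ i, α i * u i ^ 2| * Real.exp (-(∑ i, u i ^ 2) / 2)})⁻¹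

end RobustNorm

end

/-!
The upper bound `‖𝒜‖ ≤ Opt` is weak duality: for `x = P w` and `y = Q z` the block constraints give
`|yᵀ A_s x| ≤ zᵀ G_s z + wᵀ H_s w`, and summing over `s` leaves `φ_𝒮(λ) + φ_𝒯(μ)`.

For the tightness, the program is first rewritten on the product space `ℝ^q × ℝ^p`
(`blockProgram`): minimize `φ(ν)` over `ν ≥ 0` and `X_s ⪰ ±M_s` with `∑ X_s ⪯ ∑ ν_j R_j`, where
`zᵀ Qᵀ A_s P w` is the quadratic form of `M_s` at `(z, w)`. Flipping the sign of `w` shows that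
passing to the diagonal blocks of `X_s` loses nothing. The constraints bound all variables, so the
set of achievable perturbed right-hand sides is closed (`CubeProgram.isClosed_perturbed`); this
yields both the attainment of the minimum and, by Hahn-Banach separation, a dual certificate
(`CubeProgram.exists_posDef_dual`): for each `0 ≤ r < Opt` there is `D ≻ 0` with
`Tr (D R_j) ≤ t_j` for some `t ∈ 𝒮 × 𝒯` such that `r ≤ ∑ Tr (D X_s)` for all `X_s ⪰ ±M_s`.

Write `D = F Fᵀ`. The best `X_s` has `Tr (D X_s)` equal to the nuclear norm of `Fᵀ M_s F`, a
matrix of rank at most `2κ`. By rotation invariance of the standard Gaussian vector `g` and the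
definition of `ϑ`, this is at most `ϑ(2κ) E|(F g)ᵀ M_s (F g)|` (`exists_majorant_trace_le`).
With `F g = (z, w)`, choosing the signs `ε_s` realization by realization gives
`∑ |zᵀ Qᵀ A_s P w| ≤ ‖𝒜‖ ‖z‖_𝒵 ‖w‖_𝒲`. Finally `E ‖w‖_𝒲² ≤ ϰ(K)²` and `E ‖z‖_𝒵² ≤ ϰ(L)²` by a
maximal inequality for Gaussian quadratic forms of trace at most one
(`exists_integrable_majorant`); the expectation of the product is controlled by a weighted
arithmetic mean, so the correlation of `z` and `w` is irrelevant.
-/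

noncomputable section

namespace RobustNorm

open ProbabilityTheory

/-! ### The standard Gaussian measure and the function `ϑ` -/

/-- The standard Gaussian measure on `ℝ^ι`: independent `N(0, 1)` coordinates. -/
def stdNormal (ι : Type*) [Fintype ι] : Measure (ι → ℝ) :=
  Measure.pi fun _ => gaussianReal 0 1

instance {ι : Type*} [Fintype ι] : IsProbabilityMeasure (stdNormal ι) := by
  unfold stdNormal; infer_instance

section Gaussian

variable {ι κ : Type*} [Fintype ι] [Fintype κ]

lemma measurePreserving_coord (i : ι) :
    MeasurePreserving (fun u : ι → ℝ => u i) (stdNormal ι) (gaussianReal 0 1) :=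
  measurePreserving_eval (fun _ : ι => gaussianReal 0 1) i

lemma integral_comp_coord (i : ι) {f : ℝ → ℝ} (hf : Continuous f) :
    ∫ u, f (u i) ∂(stdNormal ι) = ∫ x, f x ∂(gaussianReal 0 1) := by
  rw [← (measurePreserving_coord i).map_eq, integral_map
    (measurePreserving_coord i).measurable.aemeasurable hf.aestronglyMeasurable]

lemma integrable_comp_coord (i : ι) {f : ℝ → ℝ} (hf : Integrable f (gaussianReal 0 1)) :
    Integrable (fun u => f (u i)) (stdNormal ι) :=
  (measurePreserving_coord i).integrable_comp_of_integrable hf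

/-- A subfamily of the coordinates of a standard Gaussian vector is standard Gaussian. -/
lemma stdNormal_map_comp {f : κ → ι} (hf : Function.Injective f) :
    (stdNormal ι).map (fun u => u ∘ f) = stdNormal κ := by
  have h1 : iIndepFun (fun (i : ι) (u : ι → ℝ) => id (u i)) (stdNormal ι) :=
    iIndepFun_pi (X := fun _ => id) (fun _ => aemeasurable_id)
  have h2 := h1.precomp hf
  have h3 := (iIndepFun_iff_map_fun_eq_pi_map
    (fun i => (measurable_pi_apply (f i)).aemeasurable)).1 h2
  refine h3.trans ?_
  unfold stdNormal
  congr
  ext i : 1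
  exact (measurePreserving_eval (fun _ : ι => gaussianReal 0 1) (f i)).map_eq

/-- The standard Gaussian measure has density `(2π)^{-k/2} exp(-|u|²/2)`. Since the Gaussian
density is positive, this is proved in the form "Lebesgue measure has the reciprocal density with
respect to the Gaussian measure", where independence of the coordinates is available. -/
lemma volume_eq_withDensity_stdNormal :
    (volume : Measure (ι → ℝ)) =
      (stdNormal ι).withDensity fun u => ∏ i, (gaussianPDF 0 1 (u i))⁻¹ := by
  refine Measure.pi_eq fun s hs => ?_
  have hind : ∀ u : ι → ℝ, (Set.univ.pi s).indicator
      (fun u => ∏ i, (gaussianPDF 0 1 (u i))⁻¹) u =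
      ∏ i, (s i).indicator (fun x => (gaussianPDF 0 1 x)⁻¹) (u i) := by
    intro u
    by_cases hu : u ∈ Set.univ.pi s
    · rw [Set.indicator_of_mem hu]
      exact Finset.prod_congr rfl fun i _ => by
        rw [Set.indicator_of_mem (hu i (Set.mem_univ i))]
    · rw [Set.indicator_of_notMem hu]
      simp only [Set.mem_pi, Set.mem_univ, forall_const, not_forall] at hu
      obtain ⟨i, hi⟩ := hu
      rw [eq_comm, Finset.prod_eq_zero (Finset.mem_univ i) (Set.indicator_of_notMem hi _)]
  have hmeas : ∀ i, Measurable ((s i).indicator fun x => (gaussianPDF 0 1 x)⁻¹) := fun i =>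
    (measurable_gaussianPDF 0 1).inv.indicator (hs i)
  rw [withDensity_apply _ (MeasurableSet.univ_pi hs),
    ← lintegral_indicator (MeasurableSet.univ_pi hs)]
  simp_rw [hind]
  have h1 : iIndepFun (fun (i : ι) (u : ι → ℝ) =>
      (s i).indicator (fun x => (gaussianPDF 0 1 x)⁻¹) (u i)) (stdNormal ι) :=
    iIndepFun_pi (X := fun i => (s i).indicator fun x => (gaussianPDF 0 1 x)⁻¹)
      (fun i => (hmeas i).aemeasurable)
  rw [lintegral_prod_eq_prod_lintegral_of_indepFun _ _ h1
    fun i => (hmeas i).comp (measurable_pi_apply i)]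
  refine Finset.prod_congr rfl fun i _ => ?_
  rw [(measurePreserving_coord i).lintegral_comp (hmeas i),
    gaussianReal_of_var_ne_zero 0 one_ne_zero,
    lintegral_withDensity_eq_lintegral_mul _ (measurable_gaussianPDF 0 1) (hmeas i)]
  have : ∀ x, (gaussianPDF 0 1 * (s i).indicator fun x => (gaussianPDF 0 1 x)⁻¹) x =
      (s i).indicator 1 x := by
    intro x
    by_cases hx : x ∈ s i
    · simp only [Pi.mul_apply, Set.indicator_of_mem hx, Pi.one_apply]
      exact ENNReal.mul_inv_cancel (gaussianPDF_pos 0 one_ne_zero x).ne' gaussianPDF_ne_top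
    · simp [Set.indicator_of_notMem hx]
  simp_rw [this]
  rw [lintegral_indicator_one (hs i)]

/-- The normalized Lebesgue integrals in the definition of `ϑ` are expectations with respect to the
standard Gaussian measure. -/
lemma integral_gaussian_density (F : (ι → ℝ) → ℝ) :
    (2 * Real.pi) ^ (-(Fintype.card ι : ℝ) / 2) *
      ∫ u : ι → ℝ, F u * Real.exp (-(∑ i, u i ^ 2) / 2) = ∫ u, F u ∂(stdNormal ι) := by
  rw [volume_eq_withDensity_stdNormal, integral_withDensity_eq_integral_toReal_smul
    (f := fun u : ι → ℝ => ∏ i, (gaussianPDF 0 1 (u i))⁻¹)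
    (Finset.measurable_prod _ fun i _ =>
      ((measurable_gaussianPDF 0 1).comp (measurable_pi_apply i)).inv)
    (ae_of_all _ fun u => ?_), ← integral_const_mul]
  · congr 1
    ext u
    simp only [ENNReal.toReal_prod, ENNReal.toReal_inv, toReal_gaussianPDF, gaussianPDFReal,
      smul_eq_mul, sub_zero, NNReal.coe_one, mul_one, mul_inv, inv_inv]
    rw [Finset.prod_mul_distrib, Finset.prod_const, Finset.card_univ, Finset.prod_inv_distrib,
      ← Real.exp_sum]
    have h2 : (2 * Real.pi) ^ (-(Fintype.card ι : ℝ) / 2) *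
        √(2 * Real.pi) ^ Fintype.card ι = 1 := by
      rw [Real.sqrt_eq_rpow, ← Real.rpow_natCast, ← Real.rpow_mul (by positivity),
        ← Real.rpow_add (by positivity)]
      ring_nf
      simp
    have h3 : Real.exp (∑ i, -u i ^ 2 / 2) = Real.exp (-(∑ i, u i ^ 2) / 2) := by
      rw [← Finset.sum_div, Finset.sum_neg_distrib]
    rw [h3]
    have := (Real.exp_pos (-(∑ i, u i ^ 2) / 2)).ne'
    generalize (2 * Real.pi) ^ (-(Fintype.card ι : ℝ) / 2) = a at h2 ⊢
    field_simp
    linear_combination F u * h2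
  · exact (ENNReal.prod_lt_top fun i _ =>
      ENNReal.inv_lt_top.2 (gaussianPDF_pos 0 one_ne_zero _))

lemma integrable_sq_stdNormal (i : ι) : Integrable (fun u => u i ^ 2) (stdNormal ι) :=
  integrable_comp_coord i (f := fun x : ℝ => x ^ 2)
    (memLp_id_gaussianReal (μ := 0) (v := 1) 2).integrable_sq

lemma integral_sq_stdNormal (i : ι) : ∫ u, u i ^ 2 ∂(stdNormal ι) = 1 := by
  have h := variance_id_gaussianReal (μ := 0) (v := 1)
  rw [variance_eq_sub (memLp_id_gaussianReal 2)] at h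
  rw [integral_comp_coord i (f := fun x : ℝ => x ^ 2) (by fun_prop)]
  simpa using h

/-- The diagonal quadratic form `∑ αᵢ uᵢ²`. -/
def diagForm (α : ι → ℝ) (u : ι → ℝ) : ℝ := ∑ i, α i * u i ^ 2

lemma continuous_diagForm (α : ι → ℝ) : Continuous (diagForm α) := by
  unfold diagForm; fun_prop

lemma integrable_diagForm (α : ι → ℝ) : Integrable (diagForm α) (stdNormal ι) :=
  integrable_finsetSum _ fun i _ => (integrable_sq_stdNormal i).const_mul _

/-- The quantity `E|∑ αᵢ uᵢ²|` minimized in the definition of `ϑ`. -/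
def absMoment (α : ι → ℝ) : ℝ := ∫ u, |diagForm α u| ∂(stdNormal ι)

lemma absMoment_nonneg (α : ι → ℝ) : 0 ≤ absMoment α := integral_nonneg fun _ => abs_nonneg _

lemma continuous_absMoment : Continuous (absMoment (ι := ι)) := by
  rw [continuous_iff_continuousAt]
  intro α
  refine continuousAt_of_dominated (bound := fun u => ∑ i, (|α i| + 1) * u i ^ 2)
    (Filter.Eventually.of_forall fun β =>
      (continuous_diagForm β).abs.aestronglyMeasurable) ?_
    (integrable_finsetSum _ fun i _ => (integrable_sq_stdNormal i).const_mul _)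
    (ae_of_all _ fun u => (continuous_finsetSum _ fun i _ =>
      (continuous_apply i).mul continuous_const).abs.continuousAt)
  filter_upwards [Metric.ball_mem_nhds α one_pos] with β hβ
  refine ae_of_all _ fun u => ?_
  rw [Real.norm_eq_abs, abs_abs]
  refine (Finset.abs_sum_le_sum_abs _ _).trans (Finset.sum_le_sum fun i _ => ?_)
  rw [abs_mul, abs_of_nonneg (sq_nonneg (u i))]
  refine mul_le_mul_of_nonneg_right ?_ (sq_nonneg _)
  have h1 : |β i - α i| < 1 :=
    (norm_le_pi_norm (β - α) i).trans_lt (by simpa [dist_eq_norm] using hβ)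
  have := abs_sub_abs_le_abs_sub (β i) (α i)
  linarith

instance : (stdNormal ι).IsOpenPosMeasure := by
  refine (volume_eq_withDensity_stdNormal (ι := ι) ▸ withDensity_absolutelyContinuous _ _ :
    (volume : Measure (ι → ℝ)) ≪ stdNormal ι).isOpenPosMeasure

lemma absMoment_pos {α : ι → ℝ} (hα : α ≠ 0) : 0 < absMoment α := by
  classical
  refine (absMoment_nonneg α).lt_of_ne' fun h => hα ?_
  rw [absMoment, integral_eq_zero_iff_of_nonneg (fun _ => abs_nonneg _)
    (integrable_diagForm α).abs] at h
  have h0 := Continuous.ae_eq_iff_eq (stdNormal ι) (continuous_diagForm α).abs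
    (continuous_const (y := (0 : ℝ))) |>.1 h
  ext i
  have := congrFun h0 (Pi.single i 1)
  simpa [diagForm, Pi.single_apply, abs_eq_zero] using this

lemma absMoment_smul (c : ℝ) (α : ι → ℝ) : absMoment (c • α) = |c| * absMoment α := by
  rw [absMoment, absMoment, ← integral_const_mul]
  congr 1; ext u
  rw [← abs_mul]
  simp [diagForm, Finset.mul_sum, mul_assoc]

lemma vartheta_eq (k : ℕ) :
    vartheta k = (sInf (absMoment '' {α : Fin k → ℝ | ∑ i, |α i| = 1}))⁻¹ := by
  unfold vartheta
  congr 2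
  ext r
  simp only [Set.mem_ofPred_eq, Set.mem_image]
  refine exists_congr fun α => and_congr_right fun _ => ?_
  rw [eq_comm]
  have := integral_gaussian_density (ι := Fin k) (fun u => |diagForm α u|)
  simp only [Fintype.card_fin] at this
  rw [absMoment, ← this]
  rfl

lemma exists_isLeast_absMoment {k : ℕ} (hk : 1 ≤ k) :
    ∃ c, 0 < c ∧ IsLeast (absMoment '' {α : Fin k → ℝ | ∑ i, |α i| = 1}) c := by
  have hcl : IsClosed {α : Fin k → ℝ | ∑ i, |α i| = 1} :=
    isClosed_eq (by fun_prop) continuous_const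
  have hcp : IsCompact {α : Fin k → ℝ | ∑ i, |α i| = 1} := by
    refine Metric.isCompact_of_isClosed_isBounded hcl
      ((Metric.isBounded_closedBall (x := (0 : Fin k → ℝ)) (r := 1)).subset fun α hα => ?_)
    rw [mem_closedBall_zero_iff, pi_norm_le_iff_of_nonneg zero_le_one]
    intro i
    rw [← (show ∑ i, |α i| = 1 from hα)]
    exact Finset.single_le_sum (f := fun i => |α i|) (fun _ _ => abs_nonneg _) (Finset.mem_univ i)
  have hne : {α : Fin k → ℝ | ∑ i, |α i| = 1}.Nonempty :=
    ⟨Pi.single ⟨0, hk⟩ 1, by simp [Pi.single_apply, apply_ite abs]⟩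
  obtain ⟨α, hα, hmin⟩ := hcp.exists_isMinOn hne continuous_absMoment.continuousOn
  refine ⟨absMoment α, absMoment_pos ?_, ⟨α, hα, rfl⟩, ?_⟩
  · rintro rfl
    simp at hα
  · rintro _ ⟨β, hβ, rfl⟩
    exact hmin hβ

lemma vartheta_pos {k : ℕ} (hk : 1 ≤ k) : 0 < vartheta k := by
  obtain ⟨c, hc, hl⟩ := exists_isLeast_absMoment hk
  rw [vartheta_eq, hl.csInf_eq]
  positivity

lemma sum_abs_le_vartheta_mul_absMoment_fin {k : ℕ} (hk : 1 ≤ k) (α : Fin k → ℝ) :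
    ∑ i, |α i| ≤ vartheta k * absMoment α := by
  obtain ⟨c, hc, hl⟩ := exists_isLeast_absMoment hk
  rw [vartheta_eq, hl.csInf_eq]
  rcases (Finset.sum_nonneg fun i (_ : i ∈ Finset.univ) => abs_nonneg (α i)).eq_or_lt with h | h
  · rw [← h]
    exact mul_nonneg (by positivity) (absMoment_nonneg α)
  · have h1 : c ≤ absMoment ((∑ i, |α i|)⁻¹ • α) := by
      refine hl.2 ⟨_, ?_, rfl⟩
      simp only [Set.mem_ofPred_eq, Pi.smul_apply, smul_eq_mul, abs_mul]
      rw [← Finset.mul_sum, abs_inv, abs_of_pos h, inv_mul_cancel₀ h.ne']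
    rw [absMoment_smul, abs_inv, abs_of_pos h, le_inv_mul_iff₀ h] at h1
    rw [le_inv_mul_iff₀ hc]
    linarith

lemma absMoment_comp_of_support {f : κ → ι} (hf : Function.Injective f) {α : ι → ℝ}
    (hα : ∀ i, i ∉ Set.range f → α i = 0) :
    absMoment (α ∘ f) = absMoment α := by
  rw [absMoment, ← stdNormal_map_comp hf, integral_map (φ := fun u : ι → ℝ => u ∘ f)
    (measurable_pi_lambda _ fun j => measurable_pi_apply (f j)).aemeasurable
    ((continuous_diagForm _).abs.aestronglyMeasurable)]
  unfold absMoment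
  congr 1; ext u
  congr 1
  unfold diagForm
  exact Fintype.sum_of_injective f hf _ _ (fun i hi => by simp [hα i hi]) fun i => rfl

/-- The defining inequality of `ϑ(k)` for coefficient vectors of any length with at most `k`
nonzero entries. -/
lemma sum_abs_le_vartheta_mul_absMoment {k : ℕ} (hk : 1 ≤ k) (α : ι → ℝ)
    (hα : Fintype.card {i // α i ≠ 0} ≤ k) :
    ∑ i, |α i| ≤ vartheta k * absMoment α := by
  classical
  obtain ⟨e⟩ : Nonempty ({i // α i ≠ 0} ↪ Fin k) :=
    Function.Embedding.nonempty_of_card_le (by simpa using hα)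
  -- transport the support of `α` into `Fin k`, extending by zero
  let β : Fin k → ℝ := Function.extend e (fun i => α i) 0
  have hβ : β ∘ e = fun i : {i // α i ≠ 0} => α i := by
    ext i
    exact e.injective.extend_apply (fun i : {i // α i ≠ 0} => α i) 0 i
  have hβ0 : ∀ j, j ∉ Set.range e → β j = 0 := fun j hj =>
    Function.extend_apply' _ _ _ hj
  have h1 : absMoment β = absMoment α := by
    rw [← absMoment_comp_of_support e.injective hβ0, hβ]
    refine absMoment_comp_of_support (f := fun i : {i // α i ≠ 0} => (i : ι))
      Subtype.val_injective fun i hi => ?_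
    by_contra h
    exact hi ⟨⟨i, h⟩, rfl⟩
  have h2 : ∑ j, |β j| = ∑ i, |α i| := by
    rw [← Fintype.sum_of_injective e e.injective (fun i => |α i|) (fun j => |β j|)
      (fun j hj => by simp [hβ0 j hj]) (fun i => by rw [← congrFun hβ i]; rfl)]
    refine Fintype.sum_of_injective _ Subtype.val_injective _ _ (fun i hi => ?_) fun i => rfl
    by_contra h
    exact hi ⟨⟨i, fun h' => h (by simp [h'])⟩, rfl⟩
  rw [← h1, ← h2]
  exact sum_abs_le_vartheta_mul_absMoment_fin hk β

end Gaussian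

section Rotation

variable {N : Type*} [Fintype N] [DecidableEq N] {M : Matrix N N ℝ}

/-- The standard Gaussian measure is invariant under the rotation to an eigenbasis. -/
lemma measurePreserving_eigenvectorUnitary (hM : M.IsHermitian) :
    MeasurePreserving (fun u => (hM.eigenvectorUnitary : Matrix N N ℝ) *ᵥ u)
      (stdNormal N) (stdNormal N) := by
  refine ⟨by fun_prop, ?_⟩
  have h1 := map_pi_eq_stdGaussian (ι := N)
  rw [stdGaussian_eq_map_pi_orthonormalBasis hM.eigenvectorBasis] at h1
  have h2 := congrArg (Measure.map (WithLp.ofLp (p := 2) (V := N → ℝ))) h1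
  rw [Measure.map_map (by fun_prop) (by fun_prop),
    Measure.map_map (by fun_prop) (by fun_prop)] at h2
  have h3 : (WithLp.ofLp (p := 2) (V := N → ℝ)) ∘ (WithLp.toLp 2) = id := rfl
  rw [h3, Measure.map_id] at h2
  rw [stdNormal]
  conv_rhs => rw [h2]
  congr 1
  ext u i
  simp [Matrix.mulVec, dotProduct, mul_comm]

lemma spectral_real (hM : M.IsHermitian) :
    M = (hM.eigenvectorUnitary : Matrix N N ℝ) * Matrix.diagonal hM.eigenvalues *
      (hM.eigenvectorUnitary : Matrix N N ℝ)ᵀ := by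
  conv_lhs => rw [hM.spectral_theorem]
  simp [Unitary.conjStarAlgAut_apply, Matrix.star_eq_conjTranspose]

lemma eigenvectorUnitary_transpose_mul (hM : M.IsHermitian) :
    (hM.eigenvectorUnitary : Matrix N N ℝ)ᵀ * (hM.eigenvectorUnitary : Matrix N N ℝ) = 1 := by
  have := Unitary.coe_star_mul_self hM.eigenvectorUnitary
  simpa [Matrix.star_eq_conjTranspose] using this

lemma quadForm_eigenvectorUnitary (hM : M.IsHermitian) (u : N → ℝ) :
    ((hM.eigenvectorUnitary : Matrix N N ℝ) *ᵥ u) ⬝ᵥ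
      (M *ᵥ ((hM.eigenvectorUnitary : Matrix N N ℝ) *ᵥ u)) = diagForm hM.eigenvalues u := by
  set U := (hM.eigenvectorUnitary : Matrix N N ℝ) with hU
  have h1 : Uᵀ * (M * U) = Matrix.diagonal hM.eigenvalues := by
    conv_lhs => rw [spectral_real hM, ← hU]
    have h := eigenvectorUnitary_transpose_mul hM
    rw [← hU] at h
    simp only [Matrix.mul_assoc, h, Matrix.mul_one]
    rw [← Matrix.mul_assoc, h, Matrix.one_mul]
  rw [Matrix.mulVec_mulVec, ← Matrix.vecMul_transpose, ← Matrix.dotProduct_mulVec,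
    Matrix.mulVec_mulVec, h1]
  simp only [Matrix.mulVec_diagonal, dotProduct, diagForm]
  exact Finset.sum_congr rfl fun i _ => by ring

omit [DecidableEq N] in
lemma continuous_quadForm (M : Matrix N N ℝ) : Continuous fun g : N → ℝ => g ⬝ᵥ (M *ᵥ g) := by
  fun_prop

/-- In law, a quadratic form of a standard Gaussian vector is the diagonal form given by its
eigenvalues. -/
lemma integral_comp_quadForm (hM : M.IsHermitian) {φ : ℝ → ℝ} (hφ : Continuous φ) :
    ∫ g, φ (g ⬝ᵥ (M *ᵥ g)) ∂(stdNormal N) = ∫ u, φ (diagForm hM.eigenvalues u) ∂(stdNormal N) := by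
  have h := measurePreserving_eigenvectorUnitary hM
  conv_lhs => rw [← h.map_eq]
  rw [integral_map h.measurable.aemeasurable (f := fun g => φ (g ⬝ᵥ (M *ᵥ g)))
    (hφ.comp (continuous_quadForm M)).aestronglyMeasurable]
  simp_rw [quadForm_eigenvectorUnitary]

lemma integrable_comp_quadForm (hM : M.IsHermitian) {φ : ℝ → ℝ} (hφ : Continuous φ) :
    Integrable (fun g => φ (g ⬝ᵥ (M *ᵥ g))) (stdNormal N) ↔
      Integrable (fun u => φ (diagForm hM.eigenvalues u)) (stdNormal N) := by
  have h := measurePreserving_eigenvectorUnitary hM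
  conv_lhs => rw [← h.map_eq]
  rw [integrable_map_measure (g := fun g => φ (g ⬝ᵥ (M *ᵥ g)))
    (hφ.comp (continuous_quadForm M)).aestronglyMeasurable
    h.measurable.aemeasurable]
  simp only [Function.comp_def, quadForm_eigenvectorUnitary]

lemma integrable_quadForm (hM : M.IsHermitian) :
    Integrable (fun g => g ⬝ᵥ (M *ᵥ g)) (stdNormal N) :=
  (integrable_comp_quadForm hM continuous_id).2 (integrable_diagForm _)

lemma integral_quadForm (hM : M.IsHermitian) :
    ∫ g, g ⬝ᵥ (M *ᵥ g) ∂(stdNormal N) = M.trace := by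
  have := integral_comp_quadForm hM continuous_id
  simp only [id] at this
  rw [this, hM.trace_eq_sum_eigenvalues]
  unfold diagForm
  rw [integral_finsetSum _ fun i _ => (integrable_sq_stdNormal i).const_mul _]
  simp [integral_const_mul, integral_sq_stdNormal]

lemma sum_abs_eigenvalues_le (hM : M.IsHermitian) {k : ℕ} (hk : 1 ≤ k) (hr : M.rank ≤ k) :
    ∑ i, |hM.eigenvalues i| ≤ vartheta k * ∫ g, |g ⬝ᵥ (M *ᵥ g)| ∂(stdNormal N) := by
  rw [integral_comp_quadForm hM continuous_abs]
  refine sum_abs_le_vartheta_mul_absMoment hk _ ?_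
  rw [← hM.rank_eq_card_non_zero_eigs]
  exact hr

/-- The matrix-cube bound: among the `X ⪰ ±M`, the value `Tr (D X)`, `D = F Fᵀ`, gets down to the
nuclear norm of `Fᵀ M F`, which is at most `ϑ(k) E|(F g)ᵀ M (F g)|` if `M` has rank at most `k`.
The optimal `X` is `F⁻ᵀ |Fᵀ M F| F⁻¹`. -/
lemma exists_majorant_trace_le (hM : M.IsHermitian) {k : ℕ} (hk : 1 ≤ k) (hr : M.rank ≤ k)
    {F : Matrix N N ℝ} (hF : IsUnit F) :
    ∃ X : Matrix N N ℝ, (X + M).PosSemidef ∧ (X - M).PosSemidef ∧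
      (F * Fᵀ * X).trace ≤ vartheta k *
        ∫ g, |(F *ᵥ g) ⬝ᵥ (M *ᵥ (F *ᵥ g))| ∂(stdNormal N) := by
  have hN : (Fᵀ * M * F).IsHermitian := by
    simpa using Matrix.isHermitian_conjTranspose_mul_mul F hM
  set V := (hN.eigenvectorUnitary : Matrix N N ℝ) with hV
  have hVV : Vᵀ * V = 1 := eigenvectorUnitary_transpose_mul hN
  have hdet := (Matrix.isUnit_iff_isUnit_det F).1 hF
  have hF1 : F * F⁻¹ = 1 := Matrix.mul_nonsing_inv _ hdet
  have hF2 : F⁻¹ᵀ * Fᵀ = 1 := by rw [← Matrix.transpose_mul, hF1, Matrix.transpose_one]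
  have hF3 : Fᵀ * F⁻¹ᵀ = 1 := by
    rw [← Matrix.transpose_mul, Matrix.nonsing_inv_mul _ hdet, Matrix.transpose_one]
  have hMeq : M = F⁻¹ᵀ * (V * Matrix.diagonal hN.eigenvalues * Vᵀ) * F⁻¹ := by
    rw [hV, ← spectral_real hN]
    calc M = (F⁻¹ᵀ * Fᵀ) * M * (F * F⁻¹) := by rw [hF1, hF2, Matrix.one_mul, Matrix.mul_one]
      _ = _ := by simp only [Matrix.mul_assoc]
  have key : ∀ d : N → ℝ, 0 ≤ d →
      (F⁻¹ᵀ * (V * Matrix.diagonal d * Vᵀ) * F⁻¹).PosSemidef := by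
    intro d hd
    have h1 := (Matrix.PosSemidef.diagonal hd).mul_mul_conjTranspose_same V
    simpa using h1.conjTranspose_mul_mul_same F⁻¹
  refine ⟨F⁻¹ᵀ * (V * Matrix.diagonal (fun i => |hN.eigenvalues i|) * Vᵀ) * F⁻¹, ?_, ?_, ?_⟩
  · conv => arg 1; arg 2; rw [hMeq]
    rw [← Matrix.add_mul, ← Matrix.mul_add, ← Matrix.add_mul, ← Matrix.mul_add,
      Matrix.diagonal_add]
    exact key _ fun i => show (0 : ℝ) ≤ _ by linarith [neg_abs_le (hN.eigenvalues i)]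
  · conv => arg 1; arg 2; rw [hMeq]
    rw [← Matrix.sub_mul, ← Matrix.mul_sub, ← Matrix.sub_mul, ← Matrix.mul_sub,
      Matrix.diagonal_sub]
    exact key _ fun i => show (0 : ℝ) ≤ _ by linarith [le_abs_self (hN.eigenvalues i)]
  · have htr : (F * Fᵀ * (F⁻¹ᵀ * (V * Matrix.diagonal (fun i => |hN.eigenvalues i|) * Vᵀ) *
        F⁻¹)).trace = ∑ i, |hN.eigenvalues i| := by
      rw [← Matrix.mul_assoc, Matrix.trace_mul_comm]
      simp only [← Matrix.mul_assoc]
      rw [Matrix.nonsing_inv_mul _ hdet, Matrix.one_mul, hF3, Matrix.one_mul,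
        Matrix.trace_mul_comm, ← Matrix.mul_assoc, hVV, Matrix.one_mul, Matrix.trace_diagonal]
    rw [htr]
    refine (sum_abs_eigenvalues_le hN hk ?_).trans_eq ?_
    · exact (Matrix.rank_mul_le_left _ _).trans ((Matrix.rank_mul_le_right _ _).trans hr)
    · congr 2
      ext g
      rw [Matrix.mul_assoc, ← Matrix.mulVec_mulVec, Matrix.dotProduct_mulVec,
        Matrix.vecMul_transpose, ← Matrix.mulVec_mulVec]

end Rotation

/-! ### A maximal inequality for Gaussian quadratic forms -/

section Maximal

variable {N : Type*} [Fintype N] [DecidableEq N]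

lemma gaussianPDFReal_mul_exp (x : ℝ) :
    gaussianPDFReal 0 1 x * Real.exp (x ^ 2 / 4) =
      (√(2 * Real.pi))⁻¹ * Real.exp (-(1 / 4) * x ^ 2) := by
  rw [gaussianPDFReal, mul_assoc, ← Real.exp_add]
  simp only [NNReal.coe_one, sub_zero, mul_one]
  ring_nf

lemma integrable_exp_sq_gaussianReal :
    Integrable (fun x : ℝ => Real.exp (x ^ 2 / 4)) (gaussianReal 0 1) := by
  rw [gaussianReal_of_var_ne_zero 0 one_ne_zero,
    integrable_withDensity_iff_integrable_smul' (measurable_gaussianPDF 0 1)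
      (ae_of_all _ fun _ => gaussianPDF_lt_top)]
  simp only [toReal_gaussianPDF, smul_eq_mul, gaussianPDFReal_mul_exp]
  exact (integrable_exp_neg_mul_sq (by norm_num)).const_mul _

lemma integral_exp_sq_gaussianReal :
    ∫ x : ℝ, Real.exp (x ^ 2 / 4) ∂(gaussianReal 0 1) = √2 := by
  rw [integral_gaussianReal_eq_integral_smul one_ne_zero]
  simp only [smul_eq_mul, gaussianPDFReal_mul_exp]
  rw [integral_const_mul, integral_gaussian, ← Real.sqrt_inv, ← Real.sqrt_mul (by positivity)]
  congr 1
  field_simp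
  norm_num

lemma integral_exp_quadForm_le {M : Matrix N N ℝ} (hM : M.PosSemidef) (htr : M.trace ≤ 1) :
    Integrable (fun g => Real.exp ((g ⬝ᵥ (M *ᵥ g)) / 4)) (stdNormal N) ∧
      ∫ g, Real.exp ((g ⬝ᵥ (M *ᵥ g)) / 4) ∂(stdNormal N) ≤ √2 := by
  have hφ : Continuous fun x : ℝ => Real.exp (x / 4) := by fun_prop
  rw [integrable_comp_quadForm hM.1 hφ, integral_comp_quadForm hM.1 hφ]
  have hl := hM.eigenvalues_nonneg
  set l := hM.1.eigenvalues with hl_def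
  have hs : ∑ i, l i ≤ 1 := by
    have := hM.1.trace_eq_sum_eigenvalues
    simp only [RCLike.ofReal_real_eq_id, id] at this
    rw [hl_def, ← this]
    exact htr
  -- convexity of `exp`, the missing weight being put at the origin
  have hpt : ∀ u : N → ℝ, Real.exp (diagForm l u / 4) ≤
      ∑ i, l i * Real.exp (u i ^ 2 / 4) + (1 - ∑ i, l i) := by
    intro u
    have := convexOn_exp.map_sum_le (t := (Finset.univ : Finset (Option N)))
      (w := fun o => o.elim (1 - ∑ i, l i) l) (p := fun o => o.elim 0 fun i => u i ^ 2 / 4)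
      (by rintro (_ | i) _; exacts [by simpa using hs, hl i])
      (by simp [Fintype.sum_option]) (fun _ _ => Set.mem_univ _)
    simp only [Fintype.sum_option, Option.elim_none, Option.elim_some, smul_eq_mul, mul_zero,
      zero_add, Real.exp_zero, mul_one] at this
    rw [diagForm, Finset.sum_div]
    simp_rw [mul_div_assoc]
    linarith
  have hint : ∀ i, Integrable (fun u : N → ℝ => l i * Real.exp (u i ^ 2 / 4)) (stdNormal N) :=
    fun i => (integrable_comp_coord i integrable_exp_sq_gaussianReal).const_mul _
  have hint2 : Integrable (fun u : N → ℝ => ∑ i, l i * Real.exp (u i ^ 2 / 4) + (1 - ∑ i, l i))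
      (stdNormal N) :=
    (integrable_finsetSum _ fun i _ => hint i).add (integrable_const _)
  have hI : Integrable (fun u => Real.exp (diagForm l u / 4)) (stdNormal N) := by
    refine hint2.mono' ((hφ.comp (continuous_diagForm l)).aestronglyMeasurable)
      (ae_of_all _ fun u => ?_)
    rw [Real.norm_eq_abs, Real.abs_exp]
    exact hpt u
  refine ⟨hI, (integral_mono hI hint2 hpt).trans ?_⟩
  rw [integral_add (integrable_finsetSum _ fun i _ => hint i) (integrable_const _),
    integral_finsetSum _ fun i _ => hint i]
  simp only [integral_const_mul, integral_comp_coord (f := fun x : ℝ => Real.exp (x ^ 2 / 4)) _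
    (by fun_prop), integral_exp_sq_gaussianReal, integral_const, probReal_univ, one_smul]
  rw [← Finset.sum_mul]
  have h1 : (1 : ℝ) ≤ √2 := Real.one_le_sqrt.2 (by norm_num)
  nlinarith

lemma varkappa_pos {J : ℕ} (hJ : J ≠ 0) : 0 < varkappa J := by
  unfold varkappa
  split_ifs with h
  · exact one_pos
  · have : (2 : ℝ) ≤ J := by exact_mod_cast (by omega : 2 ≤ J)
    have := Real.log_pos (show (1 : ℝ) < 2 * J by linarith)
    positivity

/-- A maximal inequality: positive semidefinite forms of trace at most one, evaluated at a
standard Gaussian vector, have a common majorant of mean at most `ϰ(K)²`. For `K > 1` the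
majorant comes from `x ≤ 4 (ln c + e^{x/4} / c - 1)` with `c = √2 K`. -/
lemma exists_integrable_majorant {K : ℕ} (hK : K ≠ 0) (R : Fin K → Matrix N N ℝ)
    (hR : ∀ k, (R k).PosSemidef) (htr : ∀ k, (R k).trace ≤ 1) :
    ∃ ψ : (N → ℝ) → ℝ, Integrable ψ (stdNormal N) ∧
      ∫ g, ψ g ∂(stdNormal N) ≤ varkappa K ^ 2 ∧ ∀ k g, g ⬝ᵥ (R k *ᵥ g) ≤ ψ g := by
  by_cases h1 : K = 1
  · subst h1
    refine ⟨fun g => g ⬝ᵥ (R 0 *ᵥ g), integrable_quadForm (hR 0).1, ?_, fun k g => ?_⟩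
    · rw [integral_quadForm (hR 0).1]
      simpa [varkappa] using htr 0
    · rw [Subsingleton.elim k 0]
  have hK2 : (2 : ℝ) ≤ K := by exact_mod_cast (by omega : 2 ≤ K)
  set c : ℝ := √2 * K with hc
  have hc0 : 0 < c := by positivity
  have hint := fun k => integral_exp_quadForm_le (hR k) (htr k)
  have hsum : Integrable (fun g => ∑ k, Real.exp ((g ⬝ᵥ (R k *ᵥ g)) / 4)) (stdNormal N) :=
    integrable_finsetSum _ fun k _ => (hint k).1
  refine ⟨fun g => 4 * (Real.log c - 1 + (∑ k, Real.exp ((g ⬝ᵥ (R k *ᵥ g)) / 4)) / c),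
    ((integrable_const _).add (hsum.div_const c)).const_mul 4, ?_, fun k g => ?_⟩
  · rw [integral_const_mul, integral_add (integrable_const _) (hsum.div_const c),
      integral_div, integral_finsetSum _ fun k _ => (hint k).1]
    simp only [integral_const, probReal_univ, one_smul]
    have h2 : (∑ k, ∫ g, Real.exp ((g ⬝ᵥ (R k *ᵥ g)) / 4) ∂(stdNormal N)) / c ≤ 1 := by
      rw [div_le_one hc0]
      refine (Finset.sum_le_sum fun k _ => (hint k).2).trans_eq ?_
      simp [hc, mul_comm]
    have h3 : Real.log c ≤ Real.log (2 * K) := Real.log_le_log hc0 (by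
      rw [hc]
      gcongr
      rw [Real.sqrt_le_left (by norm_num)]
      norm_num)
    have h4 : 0 ≤ Real.log (2 * K) := Real.log_nonneg (by linarith)
    rw [varkappa, if_neg h1, mul_pow, Real.sq_sqrt h4]
    linarith
  · have h2 : Real.exp ((g ⬝ᵥ (R k *ᵥ g)) / 4) ≤ ∑ k, Real.exp ((g ⬝ᵥ (R k *ᵥ g)) / 4) :=
      Finset.single_le_sum (f := fun k => Real.exp ((g ⬝ᵥ (R k *ᵥ g)) / 4))
        (fun _ _ => (Real.exp_pos _).le) (Finset.mem_univ k)
    have h3 := Real.log_le_sub_one_of_pos (div_pos (Real.exp_pos ((g ⬝ᵥ (R k *ᵥ g)) / 4)) hc0)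
    rw [Real.log_div (Real.exp_pos _).ne' hc0.ne', Real.log_exp] at h3
    have h4 := div_le_div_of_nonneg_right h2 hc0.le
    linarith

end Maximal

/-! ### Positive semidefinite matrices and the closedness of the perturbation set -/

section PosSemidef

variable {N : Type*} [Fintype N]

lemma posSemidef_iff_real {M : Matrix N N ℝ} :
    M.PosSemidef ↔ M.IsHermitian ∧ ∀ x, 0 ≤ x ⬝ᵥ (M *ᵥ x) := by
  simp [Matrix.posSemidef_iff_dotProduct_mulVec]

lemma isClosed_posSemidef : IsClosed {M : Matrix N N ℝ | M.PosSemidef} := by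
  simp only [posSemidef_iff_real, Matrix.IsHermitian, Set.ofPred_and, Set.ofPred_forall]
  exact (isClosed_eq (by fun_prop) continuous_id).inter
    (isClosed_iInter fun x => isClosed_le continuous_const (by fun_prop))

variable [DecidableEq N]

lemma quadForm_single_add {M : Matrix N N ℝ} (i j : N) (c : ℝ) :
    (Pi.single i 1 + c • Pi.single j 1 : N → ℝ) ⬝ᵥ (M *ᵥ (Pi.single i 1 + c • Pi.single j 1)) =
      M i i + c * M i j + c * M j i + c ^ 2 * M j j := by
  simp only [Matrix.mulVec_add, Matrix.mulVec_smul, Matrix.mulVec_single_one, add_dotProduct,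
    dotProduct_add, smul_dotProduct, dotProduct_smul, single_one_dotProduct, Matrix.col_apply,
    smul_eq_mul]
  ring

lemma abs_apply_le_trace {M : Matrix N N ℝ} (hM : M.PosSemidef) (i j : N) :
    |M i j| ≤ M.trace := by
  have hd : ∀ k, M k k ≤ M.trace := fun k =>
    Finset.single_le_sum (f := fun k => M k k) (fun k _ => hM.diag_nonneg) (Finset.mem_univ k)
  have hs : M j i = M i j := by simpa using hM.1.apply i j
  have h1 := (posSemidef_iff_real.1 hM).2 (Pi.single i 1 + (1 : ℝ) • Pi.single j 1)
  have h2 := (posSemidef_iff_real.1 hM).2 (Pi.single i 1 + (-1 : ℝ) • Pi.single j 1)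
  rw [quadForm_single_add, hs] at h1 h2
  rw [abs_le]
  constructor <;> linarith [hd i, hd j]

omit [DecidableEq N] in
lemma trace_mul_vecMulVec (D : Matrix N N ℝ) (x : N → ℝ) :
    (D * Matrix.vecMulVec x x).trace = x ⬝ᵥ (D *ᵥ x) := by
  rw [Matrix.mul_vecMulVec, Matrix.trace_vecMulVec, dotProduct_comm]

lemma exists_mul_transpose_eq {D : Matrix N N ℝ} (hD : D.PosDef) :
    ∃ F : Matrix N N ℝ, IsUnit F ∧ F * Fᵀ = D := by
  have h := spectral_real hD.1
  set U := (hD.1.eigenvectorUnitary : Matrix N N ℝ)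
  have hF : U * Matrix.diagonal (fun i => √(hD.1.eigenvalues i)) *
      (U * Matrix.diagonal fun i => √(hD.1.eigenvalues i))ᵀ = D := by
    conv_rhs => rw [h]
    rw [Matrix.transpose_mul, Matrix.diagonal_transpose, Matrix.mul_assoc,
      ← Matrix.mul_assoc _ _ Uᵀ,
      Matrix.diagonal_mul_diagonal, ← Matrix.mul_assoc]
    congr 3
    ext i
    exact Real.mul_self_sqrt (hD.eigenvalues_pos i).le
  refine ⟨_, ?_, hF⟩
  rw [Matrix.isUnit_iff_isUnit_det, isUnit_iff_ne_zero]
  intro h0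
  have := congrArg Matrix.det hF
  rw [Matrix.det_mul, h0, zero_mul] at this
  exact hD.det_pos.ne this

lemma exists_smul_one_sub_posSemidef {Y : Matrix N N ℝ} (hY : Y.IsHermitian) :
    ∃ c : ℝ, 0 ≤ c ∧ (c • (1 : Matrix N N ℝ) - Y).PosSemidef := by
  have h := spectral_real hY
  set U := (hY.eigenvectorUnitary : Matrix N N ℝ) with hU
  have hUU : U * Uᵀ = 1 := mul_eq_one_comm.1 (eigenvectorUnitary_transpose_mul hY)
  refine ⟨∑ i, |hY.eigenvalues i|, Finset.sum_nonneg fun _ _ => abs_nonneg _, ?_⟩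
  set c := ∑ i, |hY.eigenvalues i| with hc
  have h1 : c • (1 : Matrix N N ℝ) - Y =
      U * Matrix.diagonal (fun i => c - hY.eigenvalues i) * Uᵀ := by
    conv_lhs => rw [h]
    rw [← Matrix.diagonal_sub, Matrix.mul_sub, Matrix.sub_mul, ← Matrix.smul_one_eq_diagonal,
      Matrix.mul_smul, Matrix.mul_one, Matrix.smul_mul, hUU]
  rw [h1]
  refine (Matrix.PosSemidef.diagonal (d := fun i => c - hY.eigenvalues i)
    fun i => ?_).mul_mul_conjTranspose_same U
  have := Finset.single_le_sum (f := fun i => |hY.eigenvalues i|) (fun _ _ => abs_nonneg _)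
    (Finset.mem_univ i)
  have := le_abs_self (hY.eigenvalues i)
  show (0 : ℝ) ≤ c - hY.eigenvalues i
  linarith

lemma exists_smul_sub_posSemidef {D Y : Matrix N N ℝ} (hD : D.PosDef) (hY : Y.IsHermitian) :
    ∃ c : ℝ, 0 ≤ c ∧ (c • D - Y).PosSemidef := by
  obtain ⟨F, hF, rfl⟩ := exists_mul_transpose_eq hD
  have hdet := (Matrix.isUnit_iff_isUnit_det F).1 hF
  have hF1 : F * F⁻¹ = 1 := Matrix.mul_nonsing_inv _ hdet
  have hF2 : F⁻¹ᵀ * Fᵀ = 1 := by rw [← Matrix.transpose_mul, hF1, Matrix.transpose_one]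
  obtain ⟨c, hc, h⟩ := exists_smul_one_sub_posSemidef
    (Y := F⁻¹ * Y * F⁻¹ᵀ) (by simpa using Matrix.isHermitian_mul_mul_conjTranspose F⁻¹ hY)
  refine ⟨c, hc, ?_⟩
  have h2 := h.mul_mul_conjTranspose_same F
  rw [Matrix.mul_sub, Matrix.sub_mul, Matrix.mul_smul, Matrix.mul_one, Matrix.smul_mul,
    Matrix.conjTranspose_eq_transpose_of_trivial] at h2
  convert h2 using 2
  calc Y = (F * F⁻¹) * Y * (F⁻¹ᵀ * Fᵀ) := by rw [hF1, hF2, Matrix.one_mul, Matrix.mul_one]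
    _ = _ := by simp only [Matrix.mul_assoc]

end PosSemidef

/-- A monotone convex closed set of nonnegative vectors contains every nonnegative `s` satisfying
the linear inequalities with nonnegative coefficients that are valid on the set. -/
lemma mem_of_forall_nonneg_dual {ι : Type*} [Fintype ι] {T : Set (ι → ℝ)}
    (hT0 : ∀ t ∈ T, 0 ≤ t) (hTc : Convex ℝ T) (hTcl : IsClosed T)
    (hTm : ∀ t t', 0 ≤ t → t ≤ t' → t' ∈ T → t ∈ T) {s : ι → ℝ} (hs : 0 ≤ s)
    (h : ∀ (ν : ι → ℝ) (ρ : ℝ), 0 ≤ ν → (∀ t ∈ T, ν ⬝ᵥ t ≤ ρ) → ν ⬝ᵥ s ≤ ρ) : s ∈ T := by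
  classical
  by_contra hsT
  obtain ⟨f, u, hf, hu⟩ := geometric_hahn_banach_closed_point hTc hTcl hsT
  let a : ι → ℝ := fun i => f (Pi.single i 1)
  have hfa : ∀ t, f t = a ⬝ᵥ t := by
    intro t
    conv_lhs => rw [pi_eq_sum_univ' t]
    simp [a, dotProduct, mul_comm]
  have h1 : (a ⊔ 0) ⬝ᵥ s ≤ u := by
    refine h _ _ le_sup_right fun t ht => ?_
    -- by monotonicity the coordinates of `t` at the negative coefficients may be set to zero
    have ht' : (fun i => if 0 ≤ a i then t i else 0) ∈ T := by
      refine hTm _ t (fun i => ?_) (fun i => ?_) ht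
      · dsimp only
        split_ifs
        exacts [hT0 t ht i, le_rfl]
      · dsimp only
        split_ifs
        exacts [le_rfl, hT0 t ht i]
    refine le_trans (le_of_eq ?_) (hf _ ht').le
    rw [hfa]
    refine Finset.sum_congr rfl fun i _ => ?_
    simp only [Pi.sup_apply, Pi.zero_apply]
    split_ifs with hi
    · rw [sup_eq_left.2 hi]
    · rw [sup_eq_right.2 (not_le.1 hi).le]; simp
  have h2 : a ⬝ᵥ s ≤ (a ⊔ 0) ⬝ᵥ s :=
    Finset.sum_le_sum fun i _ => mul_le_mul_of_nonneg_right le_sup_left (hs i)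
  rw [hfa] at hu
  linarith

/-- The data of the semidefinite program
`min {φ_𝒯(ν) : ν ≥ 0, X_s ⪰ ±M_s, ∑ X_s ⪯ ∑ ν_j R_j}`: the forms `R_j` and the set `𝒯` of an
ellitope together with symmetric matrices `M_s`. -/
structure CubeProgram (ι N σ : Type*) [Fintype ι] [Fintype N] where
  /-- the matrices `R_j` -/
  form : ι → Matrix N N ℝ
  form_posSemidef : ∀ j, (form j).PosSemidef
  sum_form_posDef : (∑ j, form j).PosDef
  /-- the set `𝒯` -/
  bounds : Set (ι → ℝ)
  bounds_nonneg : ∀ t ∈ bounds, 0 ≤ t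
  bounds_convex : Convex ℝ bounds
  bounds_compact : IsCompact bounds
  bounds_monotone : ∀ t t' : ι → ℝ, 0 ≤ t → t ≤ t' → t' ∈ bounds → t ∈ bounds
  exists_pos_bound : ∃ t ∈ bounds, ∀ j, 0 < t j
  /-- the matrices `M_s` -/
  cost : σ → Matrix N N ℝ
  cost_isHermitian : ∀ s, (cost s).IsHermitian

namespace CubeProgram

variable {ι N σ : Type*} [Fintype ι] [Fintype N] [Fintype σ] [DecidableEq N]
  (C : CubeProgram ι N σ)

/-- The families with `X_s ⪰ ±M_s` for all `s`. -/
def Majorant (X : σ → Matrix N N ℝ) : Prop :=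
  ∀ s, (X s + C.cost s).PosSemidef ∧ (X s - C.cost s).PosSemidef

/-- The perturbation set of the program: the pairs `(Y, ρ)` such that the value `ρ` can be achieved
after `Y` is added to the right-hand side of `∑ X_s ⪯ ∑ ν_j R_j`. -/
def perturbed : Set ((N → N → ℝ) × ℝ) :=
  {y | ∃ (ν : ι → ℝ) (X : σ → Matrix N N ℝ), 0 ≤ ν ∧ C.Majorant X ∧
    (Matrix.of y.1 + ∑ j, ν j • C.form j - ∑ s, X s).PosSemidef ∧ ∀ t ∈ C.bounds, ν ⬝ᵥ t ≤ y.2}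

variable {C}

omit [Fintype σ] [DecidableEq N] in
lemma Majorant.posSemidef {X : σ → Matrix N N ℝ} (hX : C.Majorant X) (s : σ) :
    (X s).PosSemidef := by
  have h := ((hX s).1.add (hX s).2).smul (show (0 : ℝ) ≤ 1 / 2 by norm_num)
  convert h using 1
  rw [add_add_sub_cancel, ← two_smul ℝ, smul_smul]
  norm_num

variable (C)

omit [Fintype σ] in
lemma exists_majorant : ∃ X, C.Majorant X := by
  choose X hX using fun s => exists_majorant_trace_le (C.cost_isHermitian s)
    (le_max_left 1 _) (le_max_right 1 (C.cost s).rank) (F := 1) isUnit_one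
  exact ⟨X, fun s => ⟨(hX s).1, (hX s).2.1⟩⟩

lemma exists_mem_perturbed : ∃ ρ, (0, ρ) ∈ C.perturbed := by
  obtain ⟨X, hX⟩ := C.exists_majorant
  have hY : (∑ s, X s).IsHermitian :=
    (Matrix.posSemidef_sum _ fun s _ => hX.posSemidef s).1
  obtain ⟨c, hc, h⟩ := exists_smul_sub_posSemidef C.sum_form_posDef hY
  obtain ⟨ρ, hρ⟩ := (C.bounds_compact.image (f := fun t => (fun _ => c : ι → ℝ) ⬝ᵥ t)
    (by fun_prop)).bddAbove
  refine ⟨ρ, fun _ => c, X, fun _ => hc, hX, ?_, fun t ht => hρ ⟨t, ht, rfl⟩⟩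
  convert h using 2
  rw [Finset.smul_sum, add_eq_right]
  rfl

omit [DecidableEq N] in
lemma convex_perturbed : Convex ℝ C.perturbed := by
  rintro ⟨Y, ρ⟩ ⟨ν, X, hν, hX, hY, hρ⟩ ⟨Y', ρ'⟩ ⟨ν', X', hν', hX', hY', hρ'⟩ a b ha hb hab
  refine ⟨a • ν + b • ν', fun s => a • X s + b • X' s,
    add_nonneg (smul_nonneg ha hν) (smul_nonneg hb hν'), fun s => ⟨?_, ?_⟩, ?_, fun t ht => ?_⟩
  · convert ((hX s).1.smul ha).add ((hX' s).1.smul hb) using 1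
    nth_rewrite 1 [← one_smul ℝ (C.cost s)]
    rw [← hab]
    module
  · convert ((hX s).2.smul ha).add ((hX' s).2.smul hb) using 1
    nth_rewrite 1 [← one_smul ℝ (C.cost s)]
    rw [← hab]
    module
  · convert (hY.smul ha).add (hY'.smul hb) using 1
    have h1 : Matrix.of (a • Y + b • Y') = a • Matrix.of Y + b • Matrix.of Y' := rfl
    simp only [Prod.fst_add, Prod.smul_fst, h1, Pi.add_apply, Pi.smul_apply, smul_eq_mul, add_smul,
      mul_smul, Finset.sum_add_distrib, ← Finset.smul_sum]
    module
  · have h1 := mul_le_mul_of_nonneg_left (hρ t ht) ha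
    have h2 := mul_le_mul_of_nonneg_left (hρ' t ht) hb
    simp only [Prod.snd_add, Prod.smul_snd, smul_eq_mul, add_dotProduct, smul_dotProduct]
    linarith

/-- The constraints of the program bound its variables in terms of `(Y, ρ)`, so the perturbation
set is a projection along compact fibres. -/
lemma isClosed_perturbed : IsClosed C.perturbed := by
  obtain ⟨t0, ht0, ht0pos⟩ := C.exists_pos_bound
  -- the constraints, as a closed set of tuples `((Y, ρ), ν, X)`
  let Big : Set (((N → N → ℝ) × ℝ) × (ι → ℝ) × (σ → N → N → ℝ)) :=
    {z | 0 ≤ z.2.1 ∧ (∀ s, (Matrix.of (z.2.2 s) + C.cost s).PosSemidef ∧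
        (Matrix.of (z.2.2 s) - C.cost s).PosSemidef) ∧
      (Matrix.of z.1.1 + ∑ j, z.2.1 j • C.form j - ∑ s, Matrix.of (z.2.2 s)).PosSemidef ∧
      ∀ t ∈ C.bounds, z.2.1 ⬝ᵥ t ≤ z.1.2}
  have hof : Continuous (Matrix.of : (N → N → ℝ) → Matrix N N ℝ) := continuous_id
  have hBig : IsClosed Big := by
    have h1 : IsClosed {z : ((N → N → ℝ) × ℝ) × (ι → ℝ) × (σ → N → N → ℝ) | 0 ≤ z.2.1} :=
      isClosed_le continuous_const (continuous_fst.comp continuous_snd)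
    have h2 : IsClosed {z : ((N → N → ℝ) × ℝ) × (ι → ℝ) × (σ → N → N → ℝ) |
        ∀ s, (Matrix.of (z.2.2 s) + C.cost s).PosSemidef ∧
          (Matrix.of (z.2.2 s) - C.cost s).PosSemidef} := by
      simp only [Set.ofPred_forall, Set.ofPred_and]
      exact isClosed_iInter fun s =>
        (isClosed_posSemidef.preimage (f := fun z : ((N → N → ℝ) × ℝ) × (ι → ℝ) × (σ → N → N → ℝ) =>
          Matrix.of (z.2.2 s) + C.cost s) (by fun_prop)).inter
        (isClosed_posSemidef.preimage (f := fun z : ((N → N → ℝ) × ℝ) × (ι → ℝ) × (σ → N → N → ℝ) =>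
          Matrix.of (z.2.2 s) - C.cost s) (by fun_prop))
    have h3 := isClosed_posSemidef.preimage
        (f := fun z : ((N → N → ℝ) × ℝ) × (ι → ℝ) × (σ → N → N → ℝ) =>
          Matrix.of z.1.1 + ∑ j, z.2.1 j • C.form j - ∑ s, Matrix.of (z.2.2 s)) (by fun_prop)
    have h4 : IsClosed {z : ((N → N → ℝ) × ℝ) × (ι → ℝ) × (σ → N → N → ℝ) |
        ∀ t ∈ C.bounds, z.2.1 ⬝ᵥ t ≤ z.1.2} := by
      simp only [Set.ofPred_forall]
      exact isClosed_iInter fun t => isClosed_iInter fun _ =>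
        isClosed_le (by fun_prop) (by fun_prop)
    exact h1.inter (h2.inter (h3.inter h4))
  have himg : C.perturbed = Prod.fst '' Big := by
    ext y
    constructor
    · rintro ⟨ν, X, h1, h2, h3, h4⟩
      exact ⟨(y, ν, X), ⟨h1, h2, h3, h4⟩, rfl⟩
    · rintro ⟨⟨y, ν, X⟩, ⟨h1, h2, h3, h4⟩, rfl⟩
      exact ⟨ν, X, h1, h2, h3, h4⟩
  have hpiece : ∀ r : ℝ, IsClosed (C.perturbed ∩ Metric.closedBall 0 r) := by
    intro r
    let c : ℝ := ∑ _i : N, r + ∑ j, r / t0 j * (C.form j).trace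
    have hcpt : IsCompact (Big ∩ (Metric.closedBall 0 r ×ˢ
        (Set.Icc 0 (fun j => r / t0 j) ×ˢ Set.Icc (fun _ _ _ => -c) (fun _ _ _ => c)))) :=
      ((isCompact_closedBall _ _).prod (isCompact_Icc.prod isCompact_Icc)).inter_left hBig
    convert (hcpt.image continuous_fst).isClosed using 1
    rw [himg]
    ext y
    constructor
    · rintro ⟨⟨⟨⟨Y, ρ⟩, ν, X⟩, ⟨h1, h2, h3, h4⟩, rfl⟩, hy⟩
      refine ⟨⟨⟨Y, ρ⟩, ν, X⟩, ⟨⟨h1, h2, h3, h4⟩, hy, ?_⟩, rfl⟩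
      rw [mem_closedBall_zero_iff, Prod.norm_def] at hy
      obtain ⟨hYr, hρr⟩ := max_le_iff.1 hy
      dsimp only at h1 h2 h3 h4 hYr hρr
      have hρ : ρ ≤ r := (le_abs_self ρ).trans hρr
      have hν : ∀ j, ν j ≤ r / t0 j := fun j => by
        rw [le_div_iff₀ (ht0pos j)]
        exact ((Finset.single_le_sum (f := fun j => ν j * t0 j)
          (fun j _ => mul_nonneg (h1 j) (ht0pos j).le) (Finset.mem_univ j)).trans
            (h4 t0 ht0)).trans hρ
      have hX : ∀ s, (Matrix.of (X s)).PosSemidef := Majorant.posSemidef (C := C) h2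
      have hYtr : (Matrix.of Y).trace ≤ ∑ _i : N, r := Finset.sum_le_sum fun i _ =>
        ((le_abs_self _).trans (norm_le_pi_norm (Y i) i)).trans ((norm_le_pi_norm Y i).trans hYr)
      have htr := h3.trace_nonneg
      rw [Matrix.trace_sub, Matrix.trace_add, Matrix.trace_sum, Matrix.trace_sum] at htr
      simp only [Matrix.trace_smul, smul_eq_mul] at htr
      have h5 : ∑ j, ν j * (C.form j).trace ≤ ∑ j, r / t0 j * (C.form j).trace :=
        Finset.sum_le_sum fun j _ =>
          mul_le_mul_of_nonneg_right (hν j) (C.form_posSemidef j).trace_nonneg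
      have h6 : ∀ s, (Matrix.of (X s)).trace ≤ c := fun s => by
        have := Finset.single_le_sum (f := fun s => (Matrix.of (X s)).trace)
          (fun s _ => (hX s).trace_nonneg) (Finset.mem_univ s)
        dsimp only [c]
        linarith
      have h7 : ∀ s i j, |X s i j| ≤ c := fun s i j => (abs_apply_le_trace (hX s) i j).trans (h6 s)
      exact ⟨⟨h1, hν⟩, fun s i j => (abs_le.1 (h7 s i j)).1, fun s i j => (abs_le.1 (h7 s i j)).2⟩
    · rintro ⟨z, ⟨hz, hz2⟩, rfl⟩
      exact ⟨⟨z, hz, rfl⟩, hz2.1⟩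
  refine IsSeqClosed.isClosed fun y y0 hy hlim => ?_
  obtain ⟨r, hr⟩ := hlim.norm.bddAbove_range
  have hr' : ∀ n, y n ∈ C.perturbed ∩ Metric.closedBall 0 r := fun n =>
    ⟨hy n, by rw [mem_closedBall_zero_iff]; exact hr ⟨n, rfl⟩⟩
  exact ((hpiece r).mem_of_tendsto hlim (Filter.Eventually.of_forall hr')).1

omit [DecidableEq N] in
lemma nonneg_of_mem_perturbed {Y : N → N → ℝ} {ρ : ℝ} (h : (Y, ρ) ∈ C.perturbed) : 0 ≤ ρ := by
  obtain ⟨ν, X, hν, -, -, hρ⟩ := h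
  obtain ⟨t, ht, htpos⟩ := C.exists_pos_bound
  exact (Finset.sum_nonneg fun j _ => mul_nonneg (hν j) (htpos j).le).trans (hρ t ht)

lemma exists_isLeast : ∃ r, IsLeast {ρ | (0, ρ) ∈ C.perturbed} r := by
  have hcl : IsClosed {ρ : ℝ | ((0 : N → N → ℝ), ρ) ∈ C.perturbed} :=
    C.isClosed_perturbed.preimage (continuous_const.prodMk continuous_id)
  obtain ⟨ρ, hρ⟩ := C.exists_mem_perturbed
  exact ⟨_, hcl.isLeast_csInf ⟨ρ, hρ⟩ ⟨0, fun _ h => C.nonneg_of_mem_perturbed h⟩⟩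

end CubeProgram

/-! ### Semidefinite duality -/

/-- A linear functional on matrices is, on symmetric matrices, `Y ↦ Tr (D Y)` with `D`
symmetric. -/
lemma exists_trace_representation {N : Type*} [Fintype N] [DecidableEq N]
    (f : Matrix N N ℝ →ₗ[ℝ] ℝ) :
    ∃ D : Matrix N N ℝ, D.IsHermitian ∧
      ∀ Y : Matrix N N ℝ, Y.IsHermitian → f Y = (D * Y).trace := by
  let A : Matrix N N ℝ := Matrix.of fun i j => f (Matrix.single i j 1)
  refine ⟨(1 / 2 : ℝ) • (A + Aᵀ), ?_, fun Y hY => ?_⟩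
  · simp [Matrix.IsHermitian, add_comm]
  · have hYt : Yᵀ = Y := by simpa [Matrix.IsHermitian] using hY
    have h1 : f Y = (A * Yᵀ).trace := by
      conv_lhs => rw [Matrix.matrix_eq_sum_single Y]
      simp only [map_sum, Matrix.trace, Matrix.diag_apply, Matrix.mul_apply, Matrix.transpose_apply]
      refine Finset.sum_congr rfl fun i _ => Finset.sum_congr rfl fun j _ => ?_
      rw [← mul_one (Y i j), ← smul_eq_mul, ← Matrix.smul_single, map_smul]
      simp [A, mul_comm]
    have h2 : (Aᵀ * Y).trace = (A * Yᵀ).trace := by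
      rw [← Matrix.trace_transpose, Matrix.transpose_mul, Matrix.transpose_transpose,
        Matrix.trace_mul_comm]
    rw [h1, Matrix.smul_mul, Matrix.trace_smul, Matrix.add_mul, Matrix.trace_add, h2, hYt,
      smul_eq_mul]
    ring

namespace CubeProgram

variable {ι N σ : Type*} [Fintype ι] [Fintype N] [Fintype σ] [DecidableEq N]
  (C : CubeProgram ι N σ)

/-- Semidefinite duality: a value below the optimum is certified by a dual solution. -/
lemma exists_dual {r : ℝ} (hr : (0, r) ∉ C.perturbed) :
    ∃ D : Matrix N N ℝ, D.PosSemidef ∧ (fun j => (D * C.form j).trace) ∈ C.bounds ∧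
      ∀ X, C.Majorant X → r ≤ ∑ s, (D * X s).trace := by
  obtain ⟨f, u, hfu, hu⟩ :=
    geometric_hahn_banach_point_closed C.convex_perturbed C.isClosed_perturbed hr
  obtain ⟨D0, hD0, hD0f⟩ := exists_trace_representation
    ((f : ((N → N → ℝ) × ℝ) →ₗ[ℝ] ℝ) ∘ₗ LinearMap.inl ℝ (N → N → ℝ) ℝ ∘ₗ
      (LinearMap.id : (Matrix N N ℝ) →ₗ[ℝ] (N → N → ℝ)))
  set τ : ℝ := f (0, 1) with hτ
  have hf0 : ∀ (Y : N → N → ℝ) (ρ : ℝ), f (Y, ρ) = f (Y, 0) + τ * ρ := by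
    intro Y ρ
    have : (Y, ρ) = (Y, 0) + ρ • ((0 : N → N → ℝ), (1 : ℝ)) := by
      ext <;> simp
    rw [this, map_add, map_smul, smul_eq_mul, mul_comm τ]
  have hf : ∀ (Y : Matrix N N ℝ) (ρ : ℝ), Y.IsHermitian → f (Y, ρ) = (D0 * Y).trace + τ * ρ := by
    intro Y ρ hY
    rw [← hD0f Y hY]
    exact hf0 Y ρ
  have hfr : f (0, r) = τ * r := by
    have := hf 0 r Matrix.isHermitian_zero
    rw [Matrix.mul_zero, Matrix.trace_zero, zero_add] at this
    exact this
  obtain ⟨ρ0, hρ0⟩ := C.exists_mem_perturbed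
  have hmono : ∀ {Y : N → N → ℝ} {ρ ρ' : ℝ}, (Y, ρ) ∈ C.perturbed → ρ ≤ ρ' →
      (Y, ρ') ∈ C.perturbed := by
    rintro Y ρ ρ' ⟨ν, X, h1, h2, h3, h4⟩ hle
    exact ⟨ν, X, h1, h2, h3, fun t ht => (h4 t ht).trans hle⟩
  -- `(0, ρ)` with `ρ > r` large lies on the other side of the hyperplane than `(0, r)`
  have hτpos : 0 < τ := by
    have h1 := hu _ (hmono hρ0 (le_max_left ρ0 (r + 1)))
    have h2 := hf 0 (max ρ0 (r + 1)) Matrix.isHermitian_zero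
    rw [Matrix.mul_zero, Matrix.trace_zero, zero_add] at h2
    have h3 : τ * r < τ * max ρ0 (r + 1) := by
      rw [← hfr, ← h2]
      exact hfu.trans h1
    have h4 : r < max ρ0 (r + 1) := lt_max_of_lt_right (by linarith)
    by_contra h
    nlinarith
  have key : ∀ (E : Matrix N N ℝ) (ν : ι → ℝ) (ρ : ℝ) (X : σ → Matrix N N ℝ), E.PosSemidef →
      0 ≤ ν → C.Majorant X → (∀ t ∈ C.bounds, ν ⬝ᵥ t ≤ ρ) →
      τ * r < (D0 * E).trace + ∑ s, (D0 * X s).trace - ∑ j, ν j * (D0 * C.form j).trace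
        + τ * ρ := by
    intro E ν ρ X hE hν hX hρ
    have hXs : (∑ s, X s).PosSemidef := Matrix.posSemidef_sum _ fun s _ => hX.posSemidef s
    have hRs : (∑ j, ν j • C.form j).PosSemidef :=
      Matrix.posSemidef_sum _ fun j _ => (C.form_posSemidef j).smul (hν j)
    have hmem : ((E + ∑ s, X s - ∑ j, ν j • C.form j : Matrix N N ℝ), ρ) ∈ C.perturbed := by
      refine ⟨ν, X, hν, hX, ?_, hρ⟩
      convert hE using 1
      change E + ∑ s, X s - ∑ j, ν j • C.form j + ∑ j, ν j • C.form j - ∑ s, X s = E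
      abel
    have h1 := hf _ ρ ((hE.add hXs).1.sub hRs.1)
    rw [Matrix.mul_sub, Matrix.mul_add, Matrix.trace_sub, Matrix.trace_add, Finset.mul_sum,
      Finset.mul_sum, Matrix.trace_sum, Matrix.trace_sum] at h1
    simp only [Matrix.mul_smul, Matrix.trace_smul, smul_eq_mul] at h1
    rw [← hfr, ← h1]
    exact hfu.trans (hu _ hmem)
  obtain ⟨X0, hX0⟩ := C.exists_majorant
  -- a quantity `b` with `a + c b` bounded below for all `c ≥ 0` is nonnegative
  have hlin : ∀ a b d : ℝ, (∀ c : ℝ, 0 ≤ c → d < a + c * b) → 0 ≤ b := by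
    intro a b d h
    by_contra! hb
    have h0 := h 0 le_rfl
    have := h ((a - d) / -b) (div_nonneg (by linarith) (by linarith))
    have h2 : (a - d) / -b * b = -(a - d) := by
      field_simp [hb.ne]
    linarith
  have hD0psd : D0.PosSemidef := by
    refine posSemidef_iff_real.2 ⟨hD0, fun x => ?_⟩
    rw [← trace_mul_vecMulVec]
    refine hlin (∑ s, (D0 * X0 s).trace) _ (τ * r) fun c hc => ?_
    have hE : (Matrix.vecMulVec x x).PosSemidef := by
      simpa using Matrix.posSemidef_vecMulVec_self_star x
    have := key (c • Matrix.vecMulVec x x) 0 0 X0 (hE.smul hc) le_rfl hX0 (by simp)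
    simp only [Matrix.mul_smul, Matrix.trace_smul, smul_eq_mul, Pi.zero_apply, zero_mul,
      Finset.sum_const_zero, mul_zero] at this
    linarith
  have hsc : ∀ Y : Matrix N N ℝ, (τ⁻¹ • D0 * Y).trace = τ⁻¹ * (D0 * Y).trace := fun Y => by
    rw [Matrix.smul_mul, Matrix.trace_smul, smul_eq_mul]
  have htr : ∀ {Y : Matrix N N ℝ}, Y.PosSemidef → 0 ≤ (D0 * Y).trace := by
    intro Y hY
    refine hlin (∑ s, (D0 * X0 s).trace) _ (τ * r) fun c hc => ?_
    have := key (c • Y) 0 0 X0 (hY.smul hc) le_rfl hX0 (by simp)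
    simp only [Matrix.mul_smul, Matrix.trace_smul, smul_eq_mul, Pi.zero_apply, zero_mul,
      Finset.sum_const_zero, mul_zero] at this
    linarith
  refine ⟨τ⁻¹ • D0, hD0psd.smul (by positivity), ?_, fun X hX => ?_⟩
  · refine mem_of_forall_nonneg_dual C.bounds_nonneg C.bounds_convex C.bounds_compact.isClosed
      C.bounds_monotone (fun j => ?_) fun ν ρ hν hρ => ?_
    · show (0 : ℝ) ≤ (τ⁻¹ • D0 * C.form j).trace
      rw [hsc]
      exact mul_nonneg (by positivity) (htr (C.form_posSemidef j))
    · have h1 : 0 ≤ τ * ρ - ∑ j, ν j * (D0 * C.form j).trace := by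
        refine hlin (∑ s, (D0 * X0 s).trace) _ (τ * r) fun c hc => ?_
        have := key 0 (c • ν) (c * ρ) X0 Matrix.PosSemidef.zero (smul_nonneg hc hν) hX0
          fun t ht => by
            rw [smul_dotProduct, smul_eq_mul]
            exact mul_le_mul_of_nonneg_left (hρ t ht) hc
        simp only [Matrix.mul_zero, Matrix.trace_zero, Pi.smul_apply, smul_eq_mul, mul_assoc,
          ← Finset.mul_sum] at this
        linarith
      have h2 : (ν ⬝ᵥ fun j => (τ⁻¹ • D0 * C.form j).trace) =
          τ⁻¹ * ∑ j, ν j * (D0 * C.form j).trace := by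
        simp only [dotProduct, hsc, Finset.mul_sum]
        exact Finset.sum_congr rfl fun j _ => by ring
      rw [h2, inv_mul_le_iff₀ hτpos]
      linarith
  · have := key 0 0 0 X Matrix.PosSemidef.zero le_rfl hX (by simp)
    simp only [Matrix.trace_zero, Pi.zero_apply, zero_mul, Finset.sum_const_zero,
      mul_zero] at this
    simp only [hsc]
    rw [← Finset.mul_sum, le_inv_mul_iff₀ hτpos]
    linarith

/-- A dual solution can be moved slightly towards an interior point of the dual feasible set, which
makes it positive definite. -/
lemma exists_posDef_dual {r r' : ℝ} (hr : (0, r) ∉ C.perturbed) (hr' : 0 ≤ r') (hlt : r' < r) :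
    ∃ D : Matrix N N ℝ, D.PosDef ∧
      (∃ t ∈ C.bounds, ∀ j, 0 < t j ∧ (D * C.form j).trace ≤ t j) ∧
      ∀ X, C.Majorant X → r' ≤ ∑ s, (D * X s).trace := by
  obtain ⟨D, hD, hDb, hDX⟩ := C.exists_dual hr
  obtain ⟨t0, ht0, ht0pos⟩ := C.exists_pos_bound
  set δ : ℝ := 1 - r' / r with hδ
  have hr0 : 0 < r := hr'.trans_lt hlt
  have hδ0 : 0 < δ := by
    have := (div_lt_one hr0).2 hlt
    linarith
  have hδ1 : 0 ≤ 1 - δ := by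
    have := div_nonneg hr' hr0.le
    linarith
  have hη : ∃ η : ℝ, 0 < η ∧ ∀ j, η * (C.form j).trace < δ * t0 j := by
    have h1 : ∀ᶠ η : ℝ in nhdsWithin 0 (Set.Ioi 0), ∀ j, η * (C.form j).trace < δ * t0 j := by
      refine Filter.eventually_all.2 fun j => ?_
      have h2 : Filter.Tendsto (fun η : ℝ => η * (C.form j).trace) (nhds 0) (nhds 0) := by
        have : Continuous fun η : ℝ => η * (C.form j).trace := by fun_prop
        simpa using this.tendsto 0
      exact (h2.eventually_lt_const (mul_pos hδ0 (ht0pos j))).filter_mono nhdsWithin_le_nhds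
    obtain ⟨η, h3, h4⟩ := (h1.and self_mem_nhdsWithin).exists
    exact ⟨η, h4, h3⟩
  obtain ⟨η, hη0, hη⟩ := hη
  have htr : ∀ Y : Matrix N N ℝ, (((1 - δ) • D + η • (1 : Matrix N N ℝ)) * Y).trace =
      (1 - δ) * (D * Y).trace + η * Y.trace := fun Y => by
    simp [Matrix.add_mul]
  refine ⟨(1 - δ) • D + η • 1, Matrix.PosDef.posSemidef_add (hD.smul hδ1)
    (Matrix.PosDef.one.smul hη0), ⟨_, C.bounds_convex hDb ht0 hδ1 hδ0.le (by ring), fun j => ?_⟩,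
    fun X hX => ?_⟩
  · have h1 := C.bounds_nonneg _ hDb j
    have h2 := mul_pos hδ0 (ht0pos j)
    have h3 := mul_nonneg hδ1 h1
    rw [htr]
    simp only [Pi.add_apply, Pi.smul_apply, smul_eq_mul]
    exact ⟨by linarith, by linarith [hη j]⟩
  · simp only [htr]
    rw [Finset.sum_add_distrib, ← Finset.mul_sum, ← Finset.mul_sum]
    have h1 := mul_le_mul_of_nonneg_left (hDX X hX) hδ1
    have h2 : (1 - δ) * r = r' := by
      rw [hδ]
      field_simp
      ring
    have h3 : 0 ≤ η * ∑ s, (X s).trace :=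
      mul_nonneg hη0.le (Finset.sum_nonneg fun s _ => (hX.posSemidef s).trace_nonneg)
    linarith

end CubeProgram

/-! ### Ellitopes and induced norms -/

section Norms

variable {m n : ℕ}

/-- The norm whose unit ball is the polar of `C` is the support function of `C`. -/
lemma gauge_polarSet {C : Set (Fin m → ℝ)} (hC : IsCompact C) (h0 : 0 ∈ C) (v : Fin m → ℝ) :
    gauge (polarSet C) v = sSup ((fun y => v ⬝ᵥ y) '' C) := by
  have hbdd : BddAbove ((fun y => v ⬝ᵥ y) '' C) := (hC.image (by fun_prop)).bddAbove
  set h := sSup ((fun y => v ⬝ᵥ y) '' C) with hh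
  have hnn : 0 ≤ h := le_csSup hbdd ⟨0, h0, by simp⟩
  have hset : {r ∈ Set.Ioi (0 : ℝ) | r⁻¹ • v ∈ polarSet C} = {r | 0 < r ∧ h ≤ r} := by
    ext r
    refine and_congr_right fun hr => ?_
    have hr : 0 < r := hr
    simp only [polarSet, Set.mem_ofPred_eq, smul_dotProduct, smul_eq_mul]
    constructor
    · intro H
      refine csSup_le ⟨_, 0, h0, rfl⟩ ?_
      rintro _ ⟨y, hy, rfl⟩
      have := H y hy
      rwa [inv_mul_le_iff₀ hr, mul_one] at this
    · intro H y hy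
      rw [inv_mul_le_iff₀ hr, mul_one]
      exact (le_csSup hbdd ⟨y, hy, rfl⟩).trans H
  rw [gauge_def', hset]
  refine le_antisymm (le_of_forall_pos_le_add fun ε hε => ?_) ?_
  · exact csInf_le ⟨0, fun r hr => hr.1.le⟩ ⟨by linarith, by linarith⟩
  · exact le_csInf ⟨h + 1, by linarith, by linarith⟩ fun r hr => hr.2

variable {X : Set (Fin n → ℝ)} {Bstar : Set (Fin m → ℝ)}

lemma inducedNormValues_eq (hX : ∀ x, gauge X x ≤ 1 ↔ x ∈ X) (B : Set (Fin m → ℝ))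
    (M : Matrix (Fin m) (Fin n) ℝ) :
    inducedNormValues B X M = (fun x => gauge B (M *ᵥ x)) '' X := by
  ext r
  simp only [inducedNormValues, Set.mem_ofPred_eq, Set.mem_image, hX, eq_comm]

lemma continuous_gauge_polarSet_mulVec (hB : IsCompact Bstar) (h0 : 0 ∈ Bstar) :
    Continuous fun z : Matrix (Fin m) (Fin n) ℝ × (Fin n → ℝ) =>
      gauge (polarSet Bstar) (z.1 *ᵥ z.2) := by
  simp_rw [gauge_polarSet hB h0]
  exact hB.continuous_sSup (f := fun (z : Matrix (Fin m) (Fin n) ℝ × (Fin n → ℝ)) y =>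
    (z.1 *ᵥ z.2) ⬝ᵥ y) (by fun_prop)

lemma isGreatest_inducedNorm (hX : ∀ x, gauge X x ≤ 1 ↔ x ∈ X) (hXc : IsCompact X)
    (hXne : X.Nonempty) (hB : IsCompact Bstar) (h0 : 0 ∈ Bstar) (M : Matrix (Fin m) (Fin n) ℝ) :
    IsGreatest (inducedNormValues (polarSet Bstar) X M) (inducedNorm (polarSet Bstar) X M) := by
  rw [inducedNorm, inducedNormValues_eq hX]
  exact (hXc.image ((continuous_gauge_polarSet_mulVec hB h0).comp
    (continuous_const.prodMk continuous_id))).isGreatest_sSup (hXne.image _)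

lemma continuous_inducedNorm (hX : ∀ x, gauge X x ≤ 1 ↔ x ∈ X) (hXc : IsCompact X)
    (hB : IsCompact Bstar) (h0 : 0 ∈ Bstar) :
    Continuous (inducedNorm (polarSet Bstar) X) := by
  have : inducedNorm (polarSet Bstar) X = fun M : Matrix (Fin m) (Fin n) ℝ =>
      sSup ((fun x => gauge (polarSet Bstar) (M *ᵥ x)) '' X) := by
    ext M
    rw [inducedNorm, inducedNormValues_eq hX]
  rw [this]
  exact hXc.continuous_sSup (f := fun (M : Matrix (Fin m) (Fin n) ℝ) x =>
    gauge (polarSet Bstar) (M *ᵥ x)) (continuous_gauge_polarSet_mulVec hB h0)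

lemma dotProduct_le_inducedNorm (hX : ∀ x, gauge X x ≤ 1 ↔ x ∈ X) (hXc : IsCompact X)
    (hB : IsCompact Bstar) (h0 : 0 ∈ Bstar) (M : Matrix (Fin m) (Fin n) ℝ)
    {x : Fin n → ℝ} (hx : x ∈ X) {y : Fin m → ℝ} (hy : y ∈ Bstar) :
    y ⬝ᵥ (M *ᵥ x) ≤ inducedNorm (polarSet Bstar) X M := by
  refine le_trans ?_ ((isGreatest_inducedNorm hX hXc ⟨x, hx⟩ hB h0 M).2 ⟨x, (hX x).2 hx, rfl⟩)
  rw [gauge_polarSet hB h0, dotProduct_comm]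
  exact le_csSup (hB.image (by fun_prop)).bddAbove ⟨y, hy, rfl⟩

lemma inducedNorm_le (hX : ∀ x, gauge X x ≤ 1 ↔ x ∈ X) (hXne : X.Nonempty)
    (hB : IsCompact Bstar) (h0 : 0 ∈ Bstar) (M : Matrix (Fin m) (Fin n) ℝ) {c : ℝ}
    (h : ∀ x ∈ X, ∀ y ∈ Bstar, y ⬝ᵥ (M *ᵥ x) ≤ c) :
    inducedNorm (polarSet Bstar) X M ≤ c := by
  rw [inducedNorm, inducedNormValues_eq hX]
  refine csSup_le (hXne.image _) ?_
  rintro _ ⟨x, hx, rfl⟩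
  dsimp only
  rw [gauge_polarSet hB h0]
  refine csSup_le (Set.Nonempty.image _ ⟨0, h0⟩) ?_
  rintro _ ⟨y, hy, rfl⟩
  dsimp only
  rw [dotProduct_comm]
  exact h x hx y hy

lemma isCompact_boxUncertain {S : ℕ} (A : Fin S → Matrix (Fin m) (Fin n) ℝ) :
    IsCompact (boxUncertain A) := by
  have : boxUncertain A = (fun ε : Fin S → ℝ => ∑ s, ε s • A s) '' Metric.closedBall 0 1 := by
    ext M
    simp only [boxUncertain, Set.mem_ofPred_eq, Set.mem_image, mem_closedBall_zero_iff, eq_comm]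
  rw [this]
  exact (isCompact_closedBall _ _).image (by fun_prop)

lemma isGreatest_robustNorm {S : ℕ} (hX : ∀ x, gauge X x ≤ 1 ↔ x ∈ X) (hXc : IsCompact X)
    (hB : IsCompact Bstar) (h0 : 0 ∈ Bstar) (A : Fin S → Matrix (Fin m) (Fin n) ℝ) :
    IsGreatest (inducedNorm (polarSet Bstar) X '' boxUncertain A)
      (robustNorm (polarSet Bstar) X (boxUncertain A)) :=
  ((isCompact_boxUncertain A).image (continuous_inducedNorm hX hXc hB h0)).isGreatest_sSup
    (Set.Nonempty.image _ ⟨0, 0, by simp, by simp⟩)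

end Norms

section Ellitope

variable {n p K : ℕ}

lemma gauge_le_one_iff_of_symmetric {X : Set (Fin n → ℝ)} (hXc : IsCompact X) (hconv : Convex ℝ X)
    (hsymm : ∀ x ∈ X, -x ∈ X) (hint : (interior X).Nonempty) (x : Fin n → ℝ) :
    gauge X x ≤ 1 ↔ x ∈ X := by
  have h0 : X ∈ nhds (0 : Fin n → ℝ) := by
    obtain ⟨y, hy⟩ := hint
    have hX : X = -X := by
      ext z
      exact ⟨fun hz => hsymm z hz, fun hz => by simpa using hsymm _ hz⟩
    have hny : -y ∈ interior X := by
      have h1 : IsOpen (-interior X) := isOpen_interior.neg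
      have h2 : -interior X ⊆ X := fun z hz => by
        have := hsymm _ (interior_subset hz)
        simpa using this
      exact interior_maximal h2 h1 (by simpa using hy)
    have := hconv.interior hy hny (by norm_num : (0 : ℝ) ≤ 1 / 2) (by norm_num : (0 : ℝ) ≤ 1 / 2)
      (by norm_num)
    rw [smul_neg, add_neg_cancel] at this
    exact mem_interior_iff_mem_nhds.1 this
  rw [gauge_le_one_iff_mem_closure hconv h0, hXc.isClosed.closure_eq]

namespace BasicEllitope

variable (W : BasicEllitope p K)

lemma exists_pos_bound : ∃ t ∈ W.bounds, ∀ k, 0 < t k := by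
  obtain ⟨t, ht⟩ := W.bounds_interior
  obtain ⟨ε, hε, hball⟩ := Metric.isOpen_iff.1 isOpen_interior t ht
  refine ⟨t, interior_subset ht, fun k => ?_⟩
  have hmem : t - (fun _ => ε / 2) ∈ Metric.ball t ε := by
    rw [mem_ball_iff_norm, sub_sub_cancel_left, norm_neg]
    refine (pi_norm_lt_iff hε).2 fun _ => ?_
    rw [Real.norm_eq_abs, abs_of_pos (by linarith)]
    linarith
  have := W.bounds_nonneg _ (interior_subset (hball hmem)) k
  simp only [Pi.zero_apply, Pi.sub_apply] at this
  linarith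

lemma quadForm_nonneg (k : Fin K) (w : Fin p → ℝ) : 0 ≤ w ⬝ᵥ (W.form k *ᵥ w) :=
  (posSemidef_iff_real.1 (W.form_posSemidef k)).2 w

lemma zero_mem_bounds : 0 ∈ W.bounds := by
  obtain ⟨t, ht, hpos⟩ := W.exists_pos_bound
  exact W.bounds_monotone 0 t le_rfl (fun k => (hpos k).le) ht

lemma zero_mem_carrier : 0 ∈ W.carrier := ⟨0, W.zero_mem_bounds, fun k => by simp⟩

lemma neg_mem_carrier {w : Fin p → ℝ} (hw : w ∈ W.carrier) : -w ∈ W.carrier := by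
  obtain ⟨t, ht, h⟩ := hw
  exact ⟨t, ht, fun k => by simpa [Matrix.mulVec_neg] using h k⟩

lemma inv_sqrt_smul_mem_carrier {w : Fin p → ℝ} {t : Fin K → ℝ} (ht : t ∈ W.bounds) {h : ℝ}
    (hh : 0 < h) (hw : ∀ k, w ⬝ᵥ (W.form k *ᵥ w) ≤ h * t k) : (√h)⁻¹ • w ∈ W.carrier := by
  refine ⟨t, ht, fun k => ?_⟩
  rw [Matrix.mulVec_smul, smul_dotProduct, dotProduct_smul, smul_eq_mul, smul_eq_mul, ← mul_assoc,
    ← mul_inv, Real.mul_self_sqrt hh.le, inv_mul_le_iff₀ hh]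
  exact hw k

lemma convex_carrier : Convex ℝ W.carrier := by
  rintro w ⟨t, ht, hw⟩ w' ⟨t', ht', hw'⟩ a b ha hb hab
  refine ⟨a • t + b • t', W.bounds_convex ht ht' ha hb hab, fun k => ?_⟩
  have h1 := mul_le_mul_of_nonneg_left (hw k) ha
  have h2 := mul_le_mul_of_nonneg_left (hw' k) hb
  have h3 := mul_nonneg (mul_nonneg ha hb) (W.quadForm_nonneg k (w - w'))
  simp only [Matrix.mulVec_add, Matrix.mulVec_sub, Matrix.mulVec_smul, add_dotProduct,
    dotProduct_add, sub_dotProduct, dotProduct_sub, smul_dotProduct, dotProduct_smul, smul_eq_mul,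
    Pi.add_apply, Pi.smul_apply] at h1 h2 h3 ⊢
  obtain rfl : b = 1 - a := by linarith
  nlinarith

lemma isCompact_carrier : IsCompact W.carrier := by
  obtain ⟨F, hF, hFD⟩ := exists_mul_transpose_eq W.sum_form_posDef
  have hdet := (Matrix.isUnit_iff_isUnit_det F).1 hF
  have hFt : F⁻¹ᵀ * Fᵀ = 1 := by
    rw [← Matrix.transpose_mul, Matrix.mul_nonsing_inv _ hdet, Matrix.transpose_one]
  obtain ⟨r, hr⟩ := (W.bounds_compact.image (f := fun t : Fin K → ℝ => ∑ k, t k)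
    (by fun_prop)).bddAbove
  -- with `∑ T_k = F Fᵀ`, the vector `Fᵀ w` is bounded on the carrier
  let D : Set (Fin p → ℝ) := (fun v => F⁻¹ᵀ *ᵥ v) '' Metric.closedBall 0 √r
  have hD : IsCompact D := (isCompact_closedBall _ _).image (by fun_prop)
  have hsub : W.carrier ⊆ D := by
    rintro w ⟨t, ht, hw⟩
    refine ⟨Fᵀ *ᵥ w, ?_, ?_⟩
    · have h1 : (Fᵀ *ᵥ w) ⬝ᵥ (Fᵀ *ᵥ w) = ∑ k, w ⬝ᵥ (W.form k *ᵥ w) := by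
        rw [← dotProduct_sum, ← Matrix.sum_mulVec, ← hFD, ← Matrix.mulVec_mulVec,
          Matrix.dotProduct_mulVec w, ← Matrix.mulVec_transpose]
      have h2 : (Fᵀ *ᵥ w) ⬝ᵥ (Fᵀ *ᵥ w) ≤ r := by
        rw [h1]
        exact (Finset.sum_le_sum fun k _ => hw k).trans (hr ⟨t, ht, rfl⟩)
      rw [mem_closedBall_zero_iff, pi_norm_le_iff_of_nonneg (Real.sqrt_nonneg _)]
      intro i
      rw [Real.norm_eq_abs]
      refine Real.abs_le_sqrt ?_
      rw [sq]
      exact (Finset.single_le_sum (f := fun i => (Fᵀ *ᵥ w) i * (Fᵀ *ᵥ w) i)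
        (fun i _ => mul_self_nonneg _) (Finset.mem_univ i)).trans h2
    · dsimp only
      rw [Matrix.mulVec_mulVec, hFt, Matrix.one_mulVec]
  have hcl : IsClosed {z : (Fin p → ℝ) × (Fin K → ℝ) | ∀ k, z.1 ⬝ᵥ (W.form k *ᵥ z.1) ≤ z.2 k} := by
    simp only [Set.ofPred_forall]
    exact isClosed_iInter fun k => isClosed_le (by fun_prop) (by fun_prop)
  convert ((hD.prod W.bounds_compact).inter_right hcl).image continuous_fst using 1
  ext w
  constructor
  · rintro ⟨t, ht, hw⟩
    exact ⟨(w, t), ⟨⟨hsub ⟨t, ht, hw⟩, ht⟩, hw⟩, rfl⟩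
  · rintro ⟨⟨w, t⟩, ⟨⟨-, ht⟩, hw⟩, rfl⟩
    exact ⟨t, ht, hw⟩

end BasicEllitope

variable (P : Matrix (Fin n) (Fin p) ℝ) (W : BasicEllitope p K)

lemma isCompact_ellitope : IsCompact (ellitope P W) :=
  W.isCompact_carrier.image (by fun_prop)

lemma zero_mem_ellitope : 0 ∈ ellitope P W := ⟨0, W.zero_mem_carrier, by simp⟩

lemma gauge_ellitope_le_one_iff (hint : (interior (ellitope P W)).Nonempty) (x : Fin n → ℝ) :
    gauge (ellitope P W) x ≤ 1 ↔ x ∈ ellitope P W := by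
  refine gauge_le_one_iff_of_symmetric (isCompact_ellitope P W)
    (W.convex_carrier.linear_image P.mulVecLin) ?_ hint x
  rintro _ ⟨w, hw, rfl⟩
  exact ⟨-w, W.neg_mem_carrier hw, by simp [Matrix.mulVec_neg]⟩

end Ellitope

/-! ### The semidefinite program on the product space -/

section Blocks

variable {a b : Type*} [Fintype a] [Fintype b]

lemma quadForm_fromBlocks (G : Matrix a a ℝ) (E : Matrix a b ℝ) (E' : Matrix b a ℝ)
    (H : Matrix b b ℝ) (x : a ⊕ b → ℝ) :
    x ⬝ᵥ (Matrix.fromBlocks G E E' H *ᵥ x) =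
      (x ∘ Sum.inl) ⬝ᵥ (G *ᵥ (x ∘ Sum.inl)) + (x ∘ Sum.inl) ⬝ᵥ (E *ᵥ (x ∘ Sum.inr)) +
      (x ∘ Sum.inr) ⬝ᵥ (E' *ᵥ (x ∘ Sum.inl)) + (x ∘ Sum.inr) ⬝ᵥ (H *ᵥ (x ∘ Sum.inr)) := by
  conv_lhs => rw [Matrix.fromBlocks_mulVec, ← Sum.elim_comp_inl_inr x]
  rw [sumElim_dotProduct_sumElim, dotProduct_add, dotProduct_add]
  simp only [Sum.elim_comp_inl, Sum.elim_comp_inr]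
  ring

lemma posSemidef_fromBlocks_zero {G : Matrix a a ℝ} {H : Matrix b b ℝ} (hG : G.PosSemidef)
    (hH : H.PosSemidef) : (Matrix.fromBlocks G 0 0 H).PosSemidef := by
  refine posSemidef_iff_real.2 ⟨Matrix.IsHermitian.fromBlocks hG.1 (by simp) hH.1, fun x => ?_⟩
  rw [quadForm_fromBlocks]
  simpa using add_nonneg ((posSemidef_iff_real.1 hG).2 _) ((posSemidef_iff_real.1 hH).2 _)

variable [DecidableEq a] [DecidableEq b]

/-- Changing the sign of the second block of variables changes the sign of the off-diagonal
blocks. -/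
lemma posSemidef_fromBlocks_neg {G : Matrix a a ℝ} {E : Matrix a b ℝ} {E' : Matrix b a ℝ}
    {H : Matrix b b ℝ} (h : (Matrix.fromBlocks G E E' H).PosSemidef) :
    (Matrix.fromBlocks G (-E) (-E') H).PosSemidef := by
  have := h.mul_mul_conjTranspose_same
    (Matrix.fromBlocks (1 : Matrix a a ℝ) 0 0 (-1 : Matrix b b ℝ))
  simpa [Matrix.fromBlocks_multiply, Matrix.fromBlocks_transpose] using this

omit [Fintype a] [DecidableEq a] [DecidableEq b] in
lemma rank_add_le_rank_add_rank (M N : Matrix a b ℝ) : (M + N).rank ≤ M.rank + N.rank := by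
  rw [Matrix.rank, Matrix.rank, Matrix.rank, Matrix.mulVecLin_add]
  exact (Submodule.finrank_mono (LinearMap.range_add_le _ _)).trans
    (Submodule.finrank_add_le_finrank_add_finrank _ _)

lemma rank_fromBlocks_antidiagonal_le (E : Matrix a b ℝ) :
    (Matrix.fromBlocks 0 E Eᵀ 0).rank ≤ 2 * E.rank := by
  have h1 : Matrix.fromBlocks 0 E Eᵀ 0 =
      Matrix.fromRows (1 : Matrix a a ℝ) (0 : Matrix b a ℝ) * E *
        Matrix.fromCols (0 : Matrix b a ℝ) (1 : Matrix b b ℝ) +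
      Matrix.fromRows (0 : Matrix a b ℝ) (1 : Matrix b b ℝ) * Eᵀ *
        Matrix.fromCols (1 : Matrix a a ℝ) (0 : Matrix a b ℝ) := by
    ext (i | i) (j | j) <;> simp [Matrix.fromRows_mul, Matrix.mul_fromCols]
  rw [h1, two_mul]
  refine (rank_add_le_rank_add_rank _ _).trans (add_le_add ?_ ?_)
  · exact (Matrix.rank_mul_le_left _ _).trans (Matrix.rank_mul_le_right _ _)
  · exact ((Matrix.rank_mul_le_left _ _).trans (Matrix.rank_mul_le_right _ _)).trans
      (Matrix.rank_transpose E).le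

end Blocks

section SupportFn

variable {K : ℕ} {T : Set (Fin K → ℝ)}

lemma le_supportFn (hT : IsCompact T) (mu : Fin K → ℝ) {t : Fin K → ℝ} (ht : t ∈ T) :
    mu ⬝ᵥ t ≤ supportFn T mu :=
  le_csSup (hT.image (by fun_prop)).bddAbove ⟨t, ht, rfl⟩

lemma exists_eq_supportFn (hT : IsCompact T) (hne : T.Nonempty) (mu : Fin K → ℝ) :
    ∃ t ∈ T, mu ⬝ᵥ t = supportFn T mu :=
  (hT.image (f := fun t => mu ⬝ᵥ t) (by fun_prop)).sSup_mem (hne.image _)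

end SupportFn

variable {S m n p q K L : ℕ} (W : BasicEllitope p K) (Z : BasicEllitope q L)
  (P : Matrix (Fin n) (Fin p) ℝ) (Q : Matrix (Fin m) (Fin q) ℝ)
  (A : Fin S → Matrix (Fin m) (Fin n) ℝ)

/-- The program defining `Opt`, written on `ℝ^q × ℝ^p`: the forms are those of `𝒵` and `𝒲` acting
on the two blocks, the bounds are `𝒮 × 𝒯`, and `M_s` has the off-diagonal blocks `½ Qᵀ A_s P` and
its transpose. -/
def blockProgram : CubeProgram (Fin L ⊕ Fin K) (Fin q ⊕ Fin p) (Fin S) where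
  form := Sum.elim (fun l => Matrix.fromBlocks (Z.form l) 0 0 0)
    (fun k => Matrix.fromBlocks 0 0 0 (W.form k))
  form_posSemidef := by
    rintro (l | k)
    · exact posSemidef_fromBlocks_zero (Z.form_posSemidef l) Matrix.PosSemidef.zero
    · exact posSemidef_fromBlocks_zero Matrix.PosSemidef.zero (W.form_posSemidef k)
  sum_form_posDef := by
    have h : ∑ j, Sum.elim (fun l => Matrix.fromBlocks (Z.form l) 0 0 0)
        (fun k => Matrix.fromBlocks 0 0 0 (W.form k)) j =
        Matrix.fromBlocks (∑ l, Z.form l) 0 0 (∑ k, W.form k) := by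
      ext (i | i) (j | j) <;> simp [Fintype.sum_sum_type, Matrix.sum_apply]
    rw [h]
    refine Matrix.PosDef.of_dotProduct_mulVec_pos (Matrix.IsHermitian.fromBlocks
      Z.sum_form_posDef.1 (by simp) W.sum_form_posDef.1) fun x hx => ?_
    rw [star_trivial, quadForm_fromBlocks]
    simp only [Matrix.zero_mulVec, dotProduct_zero, add_zero]
    have hz := (posSemidef_iff_real.1 Z.sum_form_posDef.posSemidef).2 (x ∘ Sum.inl)
    have hw := (posSemidef_iff_real.1 W.sum_form_posDef.posSemidef).2 (x ∘ Sum.inr)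
    by_cases hz0 : x ∘ Sum.inl = 0
    · have hw0 : x ∘ Sum.inr ≠ 0 := by
        intro hw0
        apply hx
        rw [← Sum.elim_comp_inl_inr x, hz0, hw0]
        ext (i | i) <;> rfl
      have := W.sum_form_posDef.dotProduct_mulVec_pos hw0
      rw [star_trivial] at this
      linarith
    · have := Z.sum_form_posDef.dotProduct_mulVec_pos hz0
      rw [star_trivial] at this
      linarith
  bounds := {t | t ∘ Sum.inl ∈ Z.bounds ∧ t ∘ Sum.inr ∈ W.bounds}
  bounds_nonneg := by
    rintro t ⟨h1, h2⟩ (l | k)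
    exacts [Z.bounds_nonneg _ h1 l, W.bounds_nonneg _ h2 k]
  bounds_convex := by
    rintro t ⟨h1, h2⟩ t' ⟨h1', h2'⟩ c d hc hd hcd
    exact ⟨Z.bounds_convex h1 h1' hc hd hcd, W.bounds_convex h2 h2' hc hd hcd⟩
  bounds_compact := by
    have hc : Continuous fun z : (Fin L → ℝ) × (Fin K → ℝ) =>
        (Sum.elim z.1 z.2 : Fin L ⊕ Fin K → ℝ) := by
      refine continuous_pi ?_
      rintro (l | k)
      · exact (continuous_apply l).comp continuous_fst
      · exact (continuous_apply k).comp continuous_snd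
    convert (Z.bounds_compact.prod W.bounds_compact).image hc using 1
    ext t
    constructor
    · rintro ⟨h1, h2⟩
      exact ⟨(t ∘ Sum.inl, t ∘ Sum.inr), ⟨h1, h2⟩, Sum.elim_comp_inl_inr t⟩
    · rintro ⟨⟨s, t⟩, ⟨h1, h2⟩, rfl⟩
      exact ⟨h1, h2⟩
  bounds_monotone := by
    rintro t t' h0 hle ⟨h1, h2⟩
    exact ⟨Z.bounds_monotone _ _ (fun l => h0 (Sum.inl l)) (fun l => hle (Sum.inl l)) h1,
      W.bounds_monotone _ _ (fun k => h0 (Sum.inr k)) (fun k => hle (Sum.inr k)) h2⟩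
  exists_pos_bound := by
    obtain ⟨s, hs, hs0⟩ := Z.exists_pos_bound
    obtain ⟨t, ht, ht0⟩ := W.exists_pos_bound
    refine ⟨Sum.elim s t, ⟨hs, ht⟩, ?_⟩
    rintro (l | k)
    exacts [hs0 l, ht0 k]
  cost := fun s => Matrix.fromBlocks 0 ((1 / 2 : ℝ) • (Qᵀ * A s * P))
    ((1 / 2 : ℝ) • (Pᵀ * (A s)ᵀ * Q)) 0
  cost_isHermitian := fun s => by
    refine Matrix.IsHermitian.fromBlocks Matrix.isHermitian_zero ?_ Matrix.isHermitian_zero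
    simp [Matrix.conjTranspose_eq_transpose_of_trivial, Matrix.transpose_mul, Matrix.mul_assoc]

lemma mem_perturbed_of_mem_optValues {r : ℝ} (hr : r ∈ optValues W Z P Q A) :
    (0, r) ∈ (blockProgram W Z P Q A).perturbed := by
  obtain ⟨lam, mu, G, H, hlam, hmu, hGH, hG, hH, rfl⟩ := hr
  refine ⟨Sum.elim lam mu, fun s => Matrix.fromBlocks (G s) 0 0 (H s), ?_, fun s => ⟨?_, ?_⟩, ?_,
    fun t ht => ?_⟩
  · rintro (l | k)
    exacts [hlam l, hmu k]
  · simpa [blockProgram, Matrix.fromBlocks_add] using hGH s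
  · simpa [blockProgram, sub_eq_add_neg, Matrix.fromBlocks_neg, Matrix.fromBlocks_add]
      using posSemidef_fromBlocks_neg (hGH s)
  · convert posSemidef_fromBlocks_zero hG hH using 1
    ext (i | i) (j | j) <;>
      simp [blockProgram, Fintype.sum_sum_type, Matrix.sum_apply]
  · have h1 := le_supportFn Z.bounds_compact lam ht.1
    have h2 := le_supportFn W.bounds_compact mu ht.2
    have h3 : Sum.elim lam mu ⬝ᵥ t = lam ⬝ᵥ (t ∘ Sum.inl) + mu ⬝ᵥ (t ∘ Sum.inr) := by
      conv_lhs => rw [← Sum.elim_comp_inl_inr t]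
      rw [sumElim_dotProduct_sumElim]
    rw [h3]
    exact add_le_add h1 h2

/-- The diagonal blocks of a solution on `ℝ^q × ℝ^p` solve the original program. -/
lemma exists_mem_optValues_le {r : ℝ} (hr : (0, r) ∈ (blockProgram W Z P Q A).perturbed) :
    ∃ r' ≤ r, r' ∈ optValues W Z P Q A := by
  obtain ⟨ν, X, hν, hX, hsum, hρ⟩ := hr
  obtain ⟨s, hs, hs'⟩ := exists_eq_supportFn Z.bounds_compact ⟨0, Z.zero_mem_bounds⟩ (ν ∘ Sum.inl)
  obtain ⟨t, ht, ht'⟩ := exists_eq_supportFn W.bounds_compact ⟨0, W.zero_mem_bounds⟩ (ν ∘ Sum.inr)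
  refine ⟨_, ?_, ν ∘ Sum.inl, ν ∘ Sum.inr, fun s => (X s).toBlocks₁₁, fun s => (X s).toBlocks₂₂,
    fun l => hν _, fun k => hν _, fun s => ?_, ?_, ?_, rfl⟩
  · rw [← hs', ← ht', ← sumElim_dotProduct_sumElim, Sum.elim_comp_inl_inr]
    exact hρ _ ⟨hs, ht⟩
  · obtain ⟨h1, h2⟩ := hX s
    rw [← Matrix.fromBlocks_toBlocks (X s)] at h1 h2
    simp only [blockProgram, sub_eq_add_neg, Matrix.fromBlocks_neg, Matrix.fromBlocks_add,
      neg_zero, add_zero] at h1 h2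
    have h3 := (h1.add (posSemidef_fromBlocks_neg h2)).smul (show (0 : ℝ) ≤ 1 / 2 by norm_num)
    convert h3 using 1
    rw [Matrix.fromBlocks_add, Matrix.fromBlocks_smul]
    congr 1 <;> module
  · convert hsum.submatrix Sum.inl using 1
    ext i j
    simp [blockProgram, Fintype.sum_sum_type, Matrix.sum_apply, Matrix.toBlocks₁₁]
  · convert hsum.submatrix Sum.inr using 1
    ext i j
    simp [blockProgram, Fintype.sum_sum_type, Matrix.sum_apply, Matrix.toBlocks₂₂]

lemma isLeast_opt : IsLeast (optValues W Z P Q A) (opt W Z P Q A) := by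
  obtain ⟨r, hr, hmin⟩ := (blockProgram W Z P Q A).exists_isLeast
  obtain ⟨r', hle, hr'⟩ := exists_mem_optValues_le W Z P Q A hr
  have heq : r' = r := le_antisymm hle (hmin (mem_perturbed_of_mem_optValues W Z P Q A hr'))
  have h : IsLeast (optValues W Z P Q A) r :=
    ⟨heq ▸ hr', fun v hv => hmin (mem_perturbed_of_mem_optValues W Z P Q A hv)⟩
  rwa [opt, h.csInf_eq]

lemma notMem_perturbed_of_lt_opt {r : ℝ} (hr : r < opt W Z P Q A) :
    (0, r) ∉ (blockProgram W Z P Q A).perturbed := by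
  intro h
  obtain ⟨r', hle, hr'⟩ := exists_mem_optValues_le W Z P Q A h
  exact absurd ((isLeast_opt W Z P Q A).2 hr') (not_le.2 (hle.trans_lt hr))

lemma quadForm_blockProgram_cost (s : Fin S) (x : Fin q ⊕ Fin p → ℝ) :
    x ⬝ᵥ ((blockProgram W Z P Q A).cost s *ᵥ x) =
      (Q *ᵥ (x ∘ Sum.inl)) ⬝ᵥ (A s *ᵥ (P *ᵥ (x ∘ Sum.inr))) := by
  set z := x ∘ Sum.inl with hz
  set w := x ∘ Sum.inr with hw
  have h1 : z ⬝ᵥ ((Qᵀ * A s * P) *ᵥ w) = (Q *ᵥ z) ⬝ᵥ (A s *ᵥ (P *ᵥ w)) := by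
    rw [← Matrix.mulVec_mulVec, ← Matrix.mulVec_mulVec, Matrix.dotProduct_mulVec z,
      Matrix.vecMul_transpose]
  have h2 : w ⬝ᵥ ((Pᵀ * (A s)ᵀ * Q) *ᵥ z) = (Q *ᵥ z) ⬝ᵥ (A s *ᵥ (P *ᵥ w)) := by
    rw [← Matrix.mulVec_mulVec, ← Matrix.mulVec_mulVec, Matrix.dotProduct_mulVec w,
      Matrix.vecMul_transpose, Matrix.dotProduct_mulVec, Matrix.vecMul_transpose, dotProduct_comm]
  simp only [blockProgram, quadForm_fromBlocks, ← hz, ← hw, Matrix.zero_mulVec, dotProduct_zero,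
    zero_add, add_zero, Matrix.smul_mulVec, dotProduct_smul, h1, h2, smul_eq_mul]
  ring

lemma rank_blockProgram_cost_le {κ : ℕ} {s : Fin S} (hrank : (A s).rank ≤ κ) :
    ((blockProgram W Z P Q A).cost s).rank ≤ 2 * κ := by
  have h1 : (blockProgram W Z P Q A).cost s = Matrix.fromBlocks 0 ((1 / 2 : ℝ) • (Qᵀ * A s * P))
      ((1 / 2 : ℝ) • (Qᵀ * A s * P))ᵀ 0 := by
    simp [blockProgram, Matrix.transpose_mul, Matrix.mul_assoc]
  rw [h1]
  refine (rank_fromBlocks_antidiagonal_le _).trans (Nat.mul_le_mul_left 2 ?_)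
  rw [← Matrix.smul_mul]
  refine (Matrix.rank_mul_le_left _ _).trans ?_
  rw [← Matrix.smul_mul]
  exact (Matrix.rank_mul_le_right _ _).trans hrank

section Bounds

variable {X : Set (Fin n → ℝ)} {Bstar : Set (Fin m → ℝ)}

lemma sum_abs_le_robustNorm (hX : ∀ x, gauge X x ≤ 1 ↔ x ∈ X) (hXc : IsCompact X)
    (hB : IsCompact Bstar) (h0 : 0 ∈ Bstar) {x : Fin n → ℝ} (hx : x ∈ X) {y : Fin m → ℝ}
    (hy : y ∈ Bstar) :
    ∑ s, |y ⬝ᵥ (A s *ᵥ x)| ≤ robustNorm (polarSet Bstar) X (boxUncertain A) := by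
  let ε : Fin S → ℝ := fun s => SignType.sign (y ⬝ᵥ (A s *ᵥ x))
  have hε : ‖ε‖ ≤ 1 := (pi_norm_le_iff_of_nonneg zero_le_one).2 fun s => by
    dsimp only [ε]
    rcases SignType.sign (y ⬝ᵥ (A s *ᵥ x)) with _ | _ | _ <;> simp
  have h1 : ∑ s, |y ⬝ᵥ (A s *ᵥ x)| = y ⬝ᵥ ((∑ s, ε s • A s) *ᵥ x) := by
    rw [Matrix.sum_mulVec, dotProduct_sum]
    refine Finset.sum_congr rfl fun s _ => ?_
    rw [Matrix.smul_mulVec, dotProduct_smul, smul_eq_mul]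
    exact (sign_mul_self _).symm
  rw [h1]
  exact (dotProduct_le_inducedNorm hX hXc hB h0 _ hx hy).trans
    ((isGreatest_robustNorm hX hXc hB h0 A).2 ⟨_, ⟨ε, hε, rfl⟩, rfl⟩)

lemma robustNorm_nonneg (hX : ∀ x, gauge X x ≤ 1 ↔ x ∈ X) (hXc : IsCompact X)
    (hXne : X.Nonempty) (hB : IsCompact Bstar) (h0 : 0 ∈ Bstar) :
    0 ≤ robustNorm (polarSet Bstar) X (boxUncertain A) := by
  obtain ⟨x, hx⟩ := hXne
  exact (Finset.sum_nonneg fun s _ => abs_nonneg _).trans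
    (sum_abs_le_robustNorm A hX hXc hB h0 hx h0)

lemma robustNorm_le_opt (hint : (interior (ellitope P W)).Nonempty) :
    robustNorm (polarSet (ellitope Q Z)) (ellitope P W) (boxUncertain A) ≤ opt W Z P Q A := by
  have hX := gauge_ellitope_le_one_iff P W hint
  refine csSup_le (Set.Nonempty.image _ ⟨0, 0, by simp, by simp⟩) ?_
  rintro _ ⟨_, ⟨ε, hε, rfl⟩, rfl⟩
  refine inducedNorm_le hX ⟨0, zero_mem_ellitope P W⟩ (isCompact_ellitope Q Z)
    (zero_mem_ellitope Q Z) _ ?_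
  rintro _ ⟨w, ⟨t, ht, hwt⟩, rfl⟩ _ ⟨z, ⟨s, hs, hzs⟩, rfl⟩
  obtain ⟨ν, X, hν, hXmaj, hsum, hρ⟩ :=
    mem_perturbed_of_mem_optValues W Z P Q A (isLeast_opt W Z P Q A).1
  set x : Fin q ⊕ Fin p → ℝ := Sum.elim z w with hx
  have h1 : ∀ s, |(Q *ᵥ z) ⬝ᵥ (A s *ᵥ (P *ᵥ w))| ≤ x ⬝ᵥ (X s *ᵥ x) := fun s => by
    have h2 := (posSemidef_iff_real.1 (hXmaj s).1).2 x
    have h3 := (posSemidef_iff_real.1 (hXmaj s).2).2 x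
    rw [Matrix.add_mulVec, dotProduct_add, quadForm_blockProgram_cost] at h2
    rw [Matrix.sub_mulVec, dotProduct_sub, quadForm_blockProgram_cost] at h3
    simp only [hx, Sum.elim_comp_inl, Sum.elim_comp_inr] at h2 h3 ⊢
    rw [abs_le]
    constructor <;> linarith
  have h4 := (posSemidef_iff_real.1 hsum).2 x
  rw [Matrix.sub_mulVec, dotProduct_sub, Matrix.add_mulVec, dotProduct_add, Matrix.sum_mulVec,
    Matrix.sum_mulVec, dotProduct_sum, dotProduct_sum] at h4
  simp only [Matrix.smul_mulVec, dotProduct_smul, smul_eq_mul] at h4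
  have h0 : x ⬝ᵥ (Matrix.of (0 : Fin q ⊕ Fin p → Fin q ⊕ Fin p → ℝ) *ᵥ x) = 0 := by
    have : (Matrix.of (0 : Fin q ⊕ Fin p → Fin q ⊕ Fin p → ℝ)) = 0 := rfl
    rw [this, Matrix.zero_mulVec, dotProduct_zero]
  have h5 : ∑ j, ν j * (x ⬝ᵥ ((blockProgram W Z P Q A).form j *ᵥ x)) ≤ ν ⬝ᵥ Sum.elim s t := by
    refine Finset.sum_le_sum fun j _ => mul_le_mul_of_nonneg_left ?_ (hν j)
    rcases j with l | k
    · simpa [blockProgram, quadForm_fromBlocks, hx] using hzs l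
    · simpa [blockProgram, quadForm_fromBlocks, hx] using hwt k
  have h6 := hρ (Sum.elim s t) ⟨hs, ht⟩
  have h7 : (Q *ᵥ z) ⬝ᵥ ((∑ s, ε s • A s) *ᵥ (P *ᵥ w)) ≤
      ∑ s, |(Q *ᵥ z) ⬝ᵥ (A s *ᵥ (P *ᵥ w))| := by
    rw [Matrix.sum_mulVec, dotProduct_sum]
    refine Finset.sum_le_sum fun s _ => ?_
    rw [Matrix.smul_mulVec, dotProduct_smul, smul_eq_mul]
    refine (le_abs_self _).trans ?_
    rw [abs_mul]
    exact mul_le_of_le_one_left (abs_nonneg _) ((norm_le_pi_norm ε s).trans hε)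
  have h8 := Finset.sum_le_sum fun s (_ : s ∈ Finset.univ) => h1 s
  dsimp only at h6 ⊢
  linarith

/-- Positive homogeneity turns the bound on the product of the ellitopes into a bound at arbitrary
`(z, w)`; the geometric mean of the two scalings is estimated by a weighted arithmetic mean. -/
lemma sum_abs_le_of_quadForm_le (hint : (interior (ellitope P W)).Nonempty)
    {z : Fin q → ℝ} {w : Fin p → ℝ} {s : Fin L → ℝ} {t : Fin K → ℝ} (hs : s ∈ Z.bounds)
    (ht : t ∈ W.bounds) {α β c : ℝ} (hα : 0 ≤ α) (hβ : 0 ≤ β) (hc : 0 < c)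
    (hz : ∀ l, z ⬝ᵥ (Z.form l *ᵥ z) ≤ β * s l) (hw : ∀ k, w ⬝ᵥ (W.form k *ᵥ w) ≤ α * t k) :
    ∑ s, |(Q *ᵥ z) ⬝ᵥ (A s *ᵥ (P *ᵥ w))| ≤
      robustNorm (polarSet (ellitope Q Z)) (ellitope P W) (boxUncertain A) *
        ((c * α + β / c) / 2) := by
  set ρ := robustNorm (polarSet (ellitope Q Z)) (ellitope P W) (boxUncertain A) with hρ
  have hX := gauge_ellitope_le_one_iff P W hint
  have hρ0 : 0 ≤ ρ := robustNorm_nonneg A hX (isCompact_ellitope P W)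
    ⟨0, zero_mem_ellitope P W⟩ (isCompact_ellitope Q Z) (zero_mem_ellitope Q Z)
  have hrhs : 0 ≤ ρ * ((c * α + β / c) / 2) := by positivity
  have hzero : ∀ {d J : ℕ} (V : BasicEllitope d J) {v : Fin d → ℝ},
      (∀ k, v ⬝ᵥ (V.form k *ᵥ v) ≤ 0) → v = 0 := by
    intro d J V v hv
    by_contra hne
    have h1 := V.sum_form_posDef.dotProduct_mulVec_pos hne
    rw [star_trivial, Matrix.sum_mulVec, dotProduct_sum] at h1
    exact absurd (Finset.sum_nonpos fun k _ => hv k) (not_le.2 h1)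
  rcases hα.eq_or_lt with rfl | hα
  · have : w = 0 := hzero W fun k => by simpa using hw k
    simpa [this] using hrhs
  rcases hβ.eq_or_lt with rfl | hβ
  · have : z = 0 := hzero Z fun l => by simpa using hz l
    simpa [this] using hrhs
  have h1 := sum_abs_le_robustNorm A hX (isCompact_ellitope P W) (isCompact_ellitope Q Z)
    (zero_mem_ellitope Q Z) ⟨_, W.inv_sqrt_smul_mem_carrier ht hα hw, rfl⟩
    ⟨_, Z.inv_sqrt_smul_mem_carrier hs hβ hz, rfl⟩
  have hα' := Real.sqrt_pos.2 hα
  have hβ' := Real.sqrt_pos.2 hβ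
  simp only [Matrix.mulVec_smul, smul_dotProduct, dotProduct_smul, smul_eq_mul, abs_mul, abs_inv,
    abs_of_pos hα', abs_of_pos hβ', ← Finset.mul_sum] at h1
  rw [inv_mul_le_iff₀ hα', inv_mul_le_iff₀ hβ'] at h1
  refine h1.trans ?_
  have h2 : √α * √β ≤ (c * α + β / c) / 2 := by
    have h3 : 0 ≤ (c * √α - √β) ^ 2 / c := by positivity
    have h4 : (c * √α - √β) ^ 2 / c = c * (√α) ^ 2 + (√β) ^ 2 / c - 2 * (√α * √β) := by
      field_simp
      ring
    rw [h4, Real.sq_sqrt hα.le, Real.sq_sqrt hβ.le] at h3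
    linarith
  have := mul_le_mul_of_nonneg_left h2 hρ0
  linarith

lemma varkappa_nonneg (J : ℕ) : 0 ≤ varkappa J := by
  unfold varkappa
  split_ifs <;> positivity

/-- Gaussian rounding of a dual solution `D = F Fᵀ`: the blocks of `F g` lie, up to factors of mean
square `ϰ(L)²` and `ϰ(K)²`, in the two basic ellitopes. -/
lemma sum_integral_abs_le (hint : (interior (ellitope P W)).Nonempty)
    {F : Matrix (Fin q ⊕ Fin p) (Fin q ⊕ Fin p) ℝ} {t : Fin L ⊕ Fin K → ℝ}
    (ht : t ∈ (blockProgram W Z P Q A).bounds)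
    (hFt : ∀ j, 0 < t j ∧ (F * Fᵀ * (blockProgram W Z P Q A).form j).trace ≤ t j) :
    ∑ s, ∫ g, |(F *ᵥ g) ⬝ᵥ ((blockProgram W Z P Q A).cost s *ᵥ (F *ᵥ g))| ∂(stdNormal _) ≤
      varkappa K * varkappa L *
        robustNorm (polarSet (ellitope Q Z)) (ellitope P W) (boxUncertain A) := by
  set ρ := robustNorm (polarSet (ellitope Q Z)) (ellitope P W) (boxUncertain A) with hρ
  have hρ0 : 0 ≤ ρ := robustNorm_nonneg A (gauge_ellitope_le_one_iff P W hint)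
    (isCompact_ellitope P W) ⟨0, zero_mem_ellitope P W⟩ (isCompact_ellitope Q Z)
    (zero_mem_ellitope Q Z)
  have hrhs : 0 ≤ varkappa K * varkappa L * ρ :=
    mul_nonneg (mul_nonneg (varkappa_nonneg K) (varkappa_nonneg L)) hρ0
  simp_rw [quadForm_blockProgram_cost]
  -- an ellitope of size zero lives in `ℝ^0`
  have hdim : ∀ {d : ℕ} (V : BasicEllitope d 0) (v : Fin d → ℝ), v = 0 := by
    intro d V v
    by_contra hne
    have h1 := V.sum_form_posDef.dotProduct_mulVec_pos hne
    simp at h1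
  rcases Nat.eq_zero_or_pos K with rfl | hK
  · have : ∀ g : Fin q ⊕ Fin p → ℝ, (F *ᵥ g) ∘ Sum.inr = 0 := fun g => hdim W _
    simpa [this] using hrhs
  rcases Nat.eq_zero_or_pos L with rfl | hL
  · have : ∀ g : Fin q ⊕ Fin p → ℝ, (F *ᵥ g) ∘ Sum.inl = 0 := fun g => hdim Z _
    simpa [this] using hrhs
  have hϰK := varkappa_pos hK.ne'
  have hϰL := varkappa_pos hL.ne'
  let R : Fin L ⊕ Fin K → Matrix (Fin q ⊕ Fin p) (Fin q ⊕ Fin p) ℝ :=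
    fun j => (t j)⁻¹ • (Fᵀ * (blockProgram W Z P Q A).form j * F)
  have hR : ∀ j, (R j).PosSemidef := fun j => by
    have := ((blockProgram W Z P Q A).form_posSemidef j).conjTranspose_mul_mul_same F
    exact this.smul (inv_nonneg.2 (hFt j).1.le)
  have hRtr : ∀ j, (R j).trace ≤ 1 := fun j => by
    rw [Matrix.trace_smul, Matrix.trace_mul_comm, ← Matrix.mul_assoc, smul_eq_mul,
      inv_mul_le_iff₀ (hFt j).1, mul_one]
    exact (hFt j).2
  have hRq : ∀ j g, g ⬝ᵥ (R j *ᵥ g) =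
      (t j)⁻¹ * ((F *ᵥ g) ⬝ᵥ ((blockProgram W Z P Q A).form j *ᵥ (F *ᵥ g))) := fun j g => by
    rw [Matrix.smul_mulVec, dotProduct_smul, smul_eq_mul, Matrix.mul_assoc, ← Matrix.mulVec_mulVec,
      Matrix.dotProduct_mulVec, Matrix.vecMul_transpose, ← Matrix.mulVec_mulVec]
  obtain ⟨ψ, hψi, hψ, hψR⟩ := exists_integrable_majorant hK.ne' (fun k => R (Sum.inr k))
    (fun k => hR _) fun k => hRtr _
  obtain ⟨χ, hχi, hχ, hχR⟩ := exists_integrable_majorant hL.ne' (fun l => R (Sum.inl l))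
    (fun l => hR _) fun l => hRtr _
  have hψ0 : ∀ g, 0 ≤ ψ g := fun g =>
    ((posSemidef_iff_real.1 (hR _)).2 g).trans (hψR ⟨0, hK⟩ g)
  have hχ0 : ∀ g, 0 ≤ χ g := fun g =>
    ((posSemidef_iff_real.1 (hR _)).2 g).trans (hχR ⟨0, hL⟩ g)
  -- this weight balances the two terms of the arithmetic mean
  set c : ℝ := varkappa L / varkappa K with hc
  have hc0 : 0 < c := div_pos hϰL hϰK
  have hpt : ∀ g, ∑ s, |(Q *ᵥ ((F *ᵥ g) ∘ Sum.inl)) ⬝ᵥ (A s *ᵥ (P *ᵥ ((F *ᵥ g) ∘ Sum.inr)))| ≤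
      ρ * ((c * ψ g + χ g / c) / 2) := by
    intro g
    refine sum_abs_le_of_quadForm_le W Z P Q A hint ht.1 ht.2 (hψ0 g) (hχ0 g) hc0
      (fun l => ?_) fun k => ?_
    · have := hχR l g
      rw [hRq, inv_mul_le_iff₀ (hFt _).1] at this
      simpa [blockProgram, quadForm_fromBlocks, mul_comm, -Matrix.mulVec_mulVec] using this
    · have := hψR k g
      rw [hRq, inv_mul_le_iff₀ (hFt _).1] at this
      simpa [blockProgram, quadForm_fromBlocks, mul_comm, -Matrix.mulVec_mulVec] using this
  have hdom : Integrable (fun g => ρ * ((c * ψ g + χ g / c) / 2)) (stdNormal (Fin q ⊕ Fin p)) :=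
    (((hψi.const_mul c).add (hχi.div_const c)).div_const 2).const_mul ρ
  have hint' : ∀ s, Integrable (fun g => |(Q *ᵥ ((F *ᵥ g) ∘ Sum.inl)) ⬝ᵥ
      (A s *ᵥ (P *ᵥ ((F *ᵥ g) ∘ Sum.inr)))|) (stdNormal (Fin q ⊕ Fin p)) := fun s => by
    have hcont : Continuous fun g : Fin q ⊕ Fin p → ℝ =>
        |(F *ᵥ g) ⬝ᵥ ((blockProgram W Z P Q A).cost s *ᵥ (F *ᵥ g))| := by fun_prop
    simp_rw [quadForm_blockProgram_cost] at hcont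
    refine hdom.mono' hcont.aestronglyMeasurable (ae_of_all _ fun g => ?_)
    rw [Real.norm_eq_abs, abs_abs]
    exact (Finset.single_le_sum (f := fun s => |(Q *ᵥ ((F *ᵥ g) ∘ Sum.inl)) ⬝ᵥ
      (A s *ᵥ (P *ᵥ ((F *ᵥ g) ∘ Sum.inr)))|) (fun _ _ => abs_nonneg _)
      (Finset.mem_univ s)).trans (hpt g)
  rw [← integral_finsetSum _ fun s _ => hint' s]
  refine (integral_mono (integrable_finsetSum _ fun s _ => hint' s) hdom hpt).trans ?_
  rw [integral_const_mul, integral_div, integral_add (hψi.const_mul c) (hχi.div_const c),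
    integral_const_mul, integral_div, mul_comm (varkappa K * varkappa L)]
  refine mul_le_mul_of_nonneg_left ?_ hρ0
  have h1 := mul_le_mul_of_nonneg_left hψ hc0.le
  have h2 := div_le_div_of_nonneg_right hχ hc0.le
  have h3 : c * varkappa K ^ 2 = varkappa K * varkappa L := by
    rw [hc]; field_simp
  have h4 : varkappa L ^ 2 / c = varkappa K * varkappa L := by
    rw [hc]; field_simp
  linarith

lemma opt_le (hint : (interior (ellitope P W)).Nonempty) {κ : ℕ} (hκ : 1 ≤ κ)
    (hrank : ∀ s, (A s).rank ≤ κ) :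
    opt W Z P Q A ≤ varkappa K * varkappa L * vartheta (2 * κ) *
      robustNorm (polarSet (ellitope Q Z)) (ellitope P W) (boxUncertain A) := by
  set ρ := robustNorm (polarSet (ellitope Q Z)) (ellitope P W) (boxUncertain A) with hρ
  have hρ0 : 0 ≤ ρ := robustNorm_nonneg A (gauge_ellitope_le_one_iff P W hint)
    (isCompact_ellitope P W) ⟨0, zero_mem_ellitope P W⟩ (isCompact_ellitope Q Z)
    (zero_mem_ellitope Q Z)
  have hϑ : 0 < vartheta (2 * κ) := vartheta_pos (by omega)
  have hrhs : 0 ≤ varkappa K * varkappa L * vartheta (2 * κ) * ρ :=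
    mul_nonneg (mul_nonneg (mul_nonneg (varkappa_nonneg K) (varkappa_nonneg L)) hϑ.le) hρ0
  refine le_of_forall_lt_imp_le_of_dense fun r hr => ?_
  rcases lt_or_ge r 0 with hr0 | hr0
  · exact hr0.le.trans hrhs
  obtain ⟨r', hr1, hr2⟩ := exists_between hr
  obtain ⟨D, hD, ⟨t, ht, hDt⟩, hDX⟩ := (blockProgram W Z P Q A).exists_posDef_dual
    (notMem_perturbed_of_lt_opt W Z P Q A hr2) hr0 hr1
  obtain ⟨F, hF, rfl⟩ := exists_mul_transpose_eq hD
  choose X hX1 hX2 hX3 using fun s => exists_majorant_trace_le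
    ((blockProgram W Z P Q A).cost_isHermitian s) (show 1 ≤ 2 * κ by omega)
    (rank_blockProgram_cost_le W Z P Q A (hrank s)) hF
  refine (hDX X fun s => ⟨hX1 s, hX2 s⟩).trans ((Finset.sum_le_sum fun s _ => hX3 s).trans ?_)
  rw [← Finset.mul_sum]
  refine (mul_le_mul_of_nonneg_left (sum_integral_abs_le W Z P Q A hint ht hDt) hϑ.le).trans_eq ?_
  ring

end Bounds

end RobustNorm

end

theorem mainTheorem2 {S m n p q K L κ : ℕ}
    (W : RobustNorm.BasicEllitope p K) (Z : RobustNorm.BasicEllitope q L)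
    (P : Matrix (Fin n) (Fin p) ℝ) (Q : Matrix (Fin m) (Fin q) ℝ)
    (X : Set (Fin n → ℝ)) (hX : X = RobustNorm.ellitope P W) (hX_int : (interior X).Nonempty)
    (Bstar : Set (Fin m → ℝ)) (hBstar : Bstar = RobustNorm.ellitope Q Z)
    (hBstar_int : (interior Bstar).Nonempty)
    (B : Set (Fin m → ℝ)) (hB : B = RobustNorm.polarSet Bstar)
    (A : Fin S → Matrix (Fin m) (Fin n) ℝ)
    (hκ : 1 ≤ κ) (hrank : ∀ s, (A s).rank ≤ κ) :
    -- the minimum defining `Opt` and the maxima defining the norms are attained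
    IsLeast (RobustNorm.optValues W Z P Q A) (RobustNorm.opt W Z P Q A) ∧
    (∀ M : Matrix (Fin m) (Fin n) ℝ,
      IsGreatest (RobustNorm.inducedNormValues B X M) (RobustNorm.inducedNorm B X M)) ∧
    IsGreatest (RobustNorm.inducedNorm B X '' RobustNorm.boxUncertain A)
      (RobustNorm.robustNorm B X (RobustNorm.boxUncertain A)) ∧
    -- `Opt` is an upper bound on the robust norm, tight within the stated factor
    RobustNorm.robustNorm B X (RobustNorm.boxUncertain A) ≤ RobustNorm.opt W Z P Q A ∧
    RobustNorm.opt W Z P Q A ≤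
      RobustNorm.varkappa K * RobustNorm.varkappa L * RobustNorm.vartheta (2 * κ) *
        RobustNorm.robustNorm B X (RobustNorm.boxUncertain A) := by
  subst hX hBstar hB
  have hgauge := RobustNorm.gauge_ellitope_le_one_iff P W hX_int
  have hXc := RobustNorm.isCompact_ellitope P W
  have hBc := RobustNorm.isCompact_ellitope Q Z
  have hB0 := RobustNorm.zero_mem_ellitope Q Z
  exact ⟨RobustNorm.isLeast_opt W Z P Q A,
    RobustNorm.isGreatest_inducedNorm hgauge hXc ⟨0, RobustNorm.zero_mem_ellitope P W⟩ hBc hB0,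
    RobustNorm.isGreatest_robustNorm hgauge hXc hBc hB0 A,
    RobustNorm.robustNorm_le_opt W Z P Q A hX_int,
    RobustNorm.opt_le W Z P Q A hX_int hκ hrank⟩
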